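/- Let $\mathfrak{S}_n$ be the symmetric group, with simple reflections $s_i=(i\ i{+}1)$ for $1\le i\le n-1$, Coxeter length $\ell$ and reflections $T$ (the conjugates of the $s_i$), and identify a simple reflection $s_i$ with its index $i$. Let $D_L(w)=\{s_i : \ell(s_iw)<\ell(w)\}$ and $D_R(w)=\{s_i : \ell(ws_i)<\ell(w)\}$ be the left and right descent sets, let $\mathrm{supp}(w)$ be the set of simple reflections appearing in a reduced word of $w$, and for a set $J$ of simple reflections let $w_0(J)$ be the longest element of the parabolic subgroup $W_J=\langle J\rangle$. Write $w=w^Jw_J$, where $w^J$ is the element of minimal length of $wW_J$ and $w_J\in W_J$. The Bruhat order $\le$ is the reflexive and transitive closure of the relation $x\to xt$ for $t\in T$ with $\ell(xt)>\ell(x)$, and $[u,v]=\{x : u\le x\le v\}$. The undirected Bruhat graph $\Gamma(e,w)$ has vertex set $[e,w]$, with $x,y$ adjacent if and only if $y=xt$ for some $t\in T$. Call $w\in\mathfrak{S}_n$ *Bruhat irreducible* if $\mathrm{supp}(w)=\{s_1,\dots,s_{n-1}\}$ and $w$ is not a product $w'w''$ of two elements $w',w''\neq e$ with $\mathrm{supp}(w')\cap\mathrm{supp}(w'')=\emptyset$.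 A Bruhat irreducible $w$ is *almost reducible* at $(J,i)$ if $\mathrm{supp}(w^J)\cap J\subseteq D_L(w_J)$, $\mathrm{supp}(w^J)\cap J=\{s_i\}$, $s_i\notin D_L(w)$ and $s_i\notin D_R(w)$. It is *right-almost-reducible* at $i$ if it is almost reducible at $(\{s_i,\dots,s_{n-1}\},i)$, and *left-almost-reducible* at $i$ if it is almost reducible at $(\{s_1,\dots,s_i\},i)$. Let $i_1<\dots<i_k$ be the indices at which $w$ is right-almost-reducible and $j_1<\dots<j_t$ those at which it is left-almost-reducible, and set $A_R(w)=s_{i_1}\cdots s_{i_k}$, $A_L(w)=s_{j_t}\cdots s_{j_1}$ and $$v(w)=w_0(D_L(w))\cdot A_R(w)\cdot w_0(D_L(w)\cap D_R(w))\cdot A_L(w)\cdot w_0(D_R(w)).$$ **Proposition.** Let $w\in\mathfrak{S}_n$ be Bruhat irreducible and suppose that $\Gamma(e,w)$ is vertex-transitive. Then $v(w)=w$. Moreover, the orbit $\mathcal{O}=\{\varphi(e) : \varphi\in\mathrm{Aut}(\Gamma(e,w))\}$ of $e$ under the graph automorphisms of $\Gamma(e,w)$ satisfies $\mathcal{O}=[e,v(w)]$.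 -/

import Mathlib

namespace BruhatOrbit

open Equiv

/-!
The symmetric group `𝔖ₙ` is `Equiv.Perm (Fin n)`, with Coxeter generators the adjacent
transpositions. The generators are indexed by `Fin (n - 1)`: the `0`-based index `i` stands for the
transposition usually called `s_{i+1}`, exchanging the `(i+1)`-st and `(i+2)`-nd letters. Subsets
of the set of generators are given as sets of indices.
-/

section Coxeter

variable {n : ℕ}

/-- The simple reflection with index `i`, i.e. the adjacent transposition `(i, i + 1)`. -/
def simple (i : Fin (n - 1)) : Perm (Fin n) :=
  swap ⟨i.1, by omega⟩ ⟨i.1 + 1, by omega⟩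

/-- The product of a word in the simple reflections. -/
def wordProd (l : List (Fin (n - 1))) : Perm (Fin n) :=
  (l.map simple).prod

/-- The Coxeter length: the minimal length of a word in the simple reflections with product `w`
(the set is nonempty, see `exists_reducedWord`). -/
noncomputable def length (w : Perm (Fin n)) : ℕ :=
  sInf {k | ∃ l : List (Fin (n - 1)), wordProd l = w ∧ l.length = k}

/-- `l` is a reduced word of `w`. -/
def IsReducedWord (w : Perm (Fin n)) (l : List (Fin (n - 1))) : Prop :=
  wordProd l = w ∧ l.length = length w

/-- Reflections: conjugates of simple reflections. -/
def IsReflection (t : Perm (Fin n)) : Prop :=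
  ∃ (u : Perm (Fin n)) (i : Fin (n - 1)), t = u * simple i * u⁻¹

/-- The left descent set `D_L(w)`. -/
def leftDescents (w : Perm (Fin n)) : Set (Fin (n - 1)) :=
  {i | length (simple i * w) < length w}

/-- The right descent set `D_R(w)`. -/
def rightDescents (w : Perm (Fin n)) : Set (Fin (n - 1)) :=
  {i | length (w * simple i) < length w}

/-- The support of `w`: the simple reflections that appear in some reduced word of `w`. -/
def supp (w : Perm (Fin n)) : Set (Fin (n - 1)) :=
  {i | ∃ l, IsReducedWord w l ∧ i ∈ l}

/-- The parabolic subgroup `W_J` generated by the simple reflections in `J`. -/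
def parabolic (J : Set (Fin (n - 1))) : Subgroup (Perm (Fin n)) :=
  Subgroup.closure (simple '' J)

theorem exists_longest (J : Set (Fin (n - 1))) :
    ∃ x ∈ parabolic J, ∀ y ∈ parabolic J, length y ≤ length x := by
  obtain ⟨x, hx, hmax⟩ := Set.exists_max_image (parabolic J : Set (Perm (Fin n))) length
    (Set.toFinite _) ⟨1, (parabolic J).one_mem⟩
  exact ⟨x, hx, hmax⟩

/-- `w₀(J)`, the longest element of the parabolic subgroup `W_J`. -/
noncomputable def longest (J : Set (Fin (n - 1))) : Perm (Fin n) :=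
  (exists_longest J).choose

theorem exists_minCosetRep (w : Perm (Fin n)) (J : Set (Fin (n - 1))) :
    ∃ x, w⁻¹ * x ∈ parabolic J ∧ ∀ y, w⁻¹ * y ∈ parabolic J → length x ≤ length y := by
  obtain ⟨x, hx, hmin⟩ := Set.exists_min_image {x | w⁻¹ * x ∈ parabolic J} length
    (Set.toFinite _) ⟨w, by simp⟩
  exact ⟨x, hx, hmin⟩

/-- `w^J`, the element of minimal length of the coset `w W_J`. -/
noncomputable def cosetPart (w : Perm (Fin n)) (J : Set (Fin (n - 1))) : Perm (Fin n) :=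
  (exists_minCosetRep w J).choose

/-- `w_J`, determined by `w = w^J w_J`. -/
noncomputable def parabolicPart (w : Perm (Fin n)) (J : Set (Fin (n - 1))) : Perm (Fin n) :=
  (cosetPart w J)⁻¹ * w

/-- The parabolic decomposition `w = w^J w_J` is a Billey–Postnikov decomposition. -/
def IsBPDecomposition (w : Perm (Fin n)) (J : Set (Fin (n - 1))) : Prop :=
  supp (cosetPart w J) ∩ J ⊆ leftDescents (parabolicPart w J)

end Coxeter

section Bruhat

variable {n : ℕ}

/-- The edges `x → y` of the directed Bruhat graph: `y = x t` for a reflection `t`, and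
`ℓ(y) > ℓ(x)`. -/
def BruhatEdge (x y : Perm (Fin n)) : Prop :=
  ∃ t, IsReflection t ∧ y = x * t ∧ length x < length y

/-- The (strong) Bruhat order. -/
def BruhatLE (x y : Perm (Fin n)) : Prop :=
  Relation.ReflTransGen BruhatEdge x y

/-- The Bruhat interval `[u, v]`. -/
def bruhatInterval (u v : Perm (Fin n)) : Set (Perm (Fin n)) :=
  {x | BruhatLE u x ∧ BruhatLE x v}

/-- The undirected Bruhat graph on the whole group. -/
def bruhatGraph (n : ℕ) : SimpleGraph (Perm (Fin n)) :=
  SimpleGraph.fromRel BruhatEdge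

/-- The undirected Bruhat graph `Γ(u, v)`, the restriction to the vertex set `[u, v]`. -/
def intervalGraph (u v : Perm (Fin n)) : SimpleGraph (bruhatInterval u v) :=
  (bruhatGraph n).induce (bruhatInterval u v)

/-- A graph is vertex-transitive if its automorphisms act transitively on its vertices. -/
def IsVertexTransitive {V : Type*} (G : SimpleGraph V) : Prop :=
  ∀ x y : V, ∃ φ : G ≃g G, φ x = y

theorem exists_wordProd_eq (w : Perm (Fin n)) : ∃ l : List (Fin (n - 1)), wordProd l = w := by
  cases n with
  | zero => exact ⟨[], Subsingleton.elim _ _⟩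
  | succ m =>
    have hw : w ∈ Submonoid.closure
        (Set.range fun i : Fin m ↦ swap i.castSucc i.succ) := by
      rw [Perm.mclosure_swap_castSucc_succ]; trivial
    induction hw using Submonoid.closure_induction with
    | mem x hx =>
      obtain ⟨i, rfl⟩ := hx
      exact ⟨[i], by simp [wordProd, simple]; rfl⟩
    | one => exact ⟨[], rfl⟩
    | mul x y _ _ hx hy =>
      obtain ⟨l, rfl⟩ := hx
      obtain ⟨l', rfl⟩ := hy
      exact ⟨l ++ l', by simp [wordProd]⟩

theorem length_wordProd_le (l : List (Fin (n - 1))) : length (wordProd l) ≤ l.length :=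
  Nat.sInf_le ⟨l, rfl, rfl⟩

theorem exists_reducedWord (w : Perm (Fin n)) : ∃ l, IsReducedWord w l := by
  obtain ⟨l, hl⟩ := exists_wordProd_eq w
  exact Nat.sInf_mem (s := {k | ∃ l : List (Fin (n - 1)), wordProd l = w ∧ l.length = k})
    ⟨_, l, hl, rfl⟩

theorem one_bruhatLE (w : Perm (Fin n)) : BruhatLE 1 w := by
  obtain ⟨l, hl, hlen⟩ := exists_reducedWord w
  induction l using List.reverseRecOn generalizing w with
  | nil => subst hl; exact Relation.ReflTransGen.refl
  | append_singleton l i ih =>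
    have hw : w = wordProd l * simple i := by simp [← hl, wordProd]
    have hle : length (wordProd l) ≤ l.length := length_wordProd_le l
    simp only [List.length_append, List.length_singleton] at hlen
    have hge : length w ≤ length (wordProd l) + 1 := by
      obtain ⟨l', h1, h2⟩ := exists_reducedWord (wordProd l)
      have h3 : wordProd (l' ++ [i]) = w := by
        rw [hw, ← h1]; simp [wordProd]
      have h4 := length_wordProd_le (l' ++ [i])
      rw [h3] at h4
      simpa [h2] using h4
    refine (ih (wordProd l) rfl (by omega)).tail ⟨simple i, ⟨1, i, by simp⟩, hw, by omega⟩

/-- The orbit of the identity under the automorphism group of `Γ(e, w)`. -/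
def identityOrbit (w : Perm (Fin n)) : Set (Perm (Fin n)) :=
  {x | ∃ φ : intervalGraph 1 w ≃g intervalGraph 1 w,
    (φ ⟨1, Relation.ReflTransGen.refl, one_bruhatLE w⟩ : Perm (Fin n)) = x}

end Bruhat

section AlmostReducible

variable {n : ℕ}

/-- `w` is Bruhat irreducible: it has full support and admits no disjoint support decomposition,
i.e. it is not a product of two nontrivial elements with disjoint supports. -/
def BruhatIrreducible (w : Perm (Fin n)) : Prop :=
  supp w = Set.univ ∧
    ¬ ∃ w' w'' : Perm (Fin n), w' ≠ 1 ∧ w'' ≠ 1 ∧ w = w' * w'' ∧ Disjoint (supp w') (supp w'')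

/-- `w` is almost reducible at `(J, i)`. -/
def AlmostReducible (w : Perm (Fin n)) (J : Set (Fin (n - 1))) (i : Fin (n - 1)) : Prop :=
  BruhatIrreducible w ∧ IsBPDecomposition w J ∧ supp (cosetPart w J) ∩ J = {i} ∧
    i ∉ leftDescents w ∧ i ∉ rightDescents w

/-- `w` is almost reducible at `({s_i, …, s_{n-1}}, i)`. -/
def RightAlmostReducible (w : Perm (Fin n)) (i : Fin (n - 1)) : Prop :=
  AlmostReducible w (Set.Ici i) i

/-- `w` is almost reducible at `({s_1, …, s_i}, i)`. -/
def LeftAlmostReducible (w : Perm (Fin n)) (i : Fin (n - 1)) : Prop :=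
  AlmostReducible w (Set.Iic i) i

open Classical in
/-- `A_R(w)`: the product, with indices increasing from left to right, of the simple reflections
at whose index `w` is right-almost-reducible. -/
noncomputable def rightProd (w : Perm (Fin n)) : Perm (Fin n) :=
  wordProd ((List.finRange (n - 1)).filter fun i => RightAlmostReducible w i)

open Classical in
/-- `A_L(w)`: the product, with indices decreasing from left to right, of the simple reflections
at whose index `w` is left-almost-reducible. -/
noncomputable def leftProd (w : Perm (Fin n)) : Perm (Fin n) :=
  wordProd ((List.finRange (n - 1)).filter fun i => LeftAlmostReducible w i).reverse

/-- `v(w) = w₀(D_L(w)) · A_R(w) · w₀(D_L(w) ∩ D_R(w)) · A_L(w) · w₀(D_R(w))`. -/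
noncomputable def orbitTop (w : Perm (Fin n)) : Perm (Fin n) :=
  longest (leftDescents w) * rightProd w * longest (leftDescents w ∩ rightDescents w) *
    leftProd w * longest (rightDescents w)

end AlmostReducible

end BruhatOrbit

/-!
Write `t ≤ w` for the Bruhat order and put `J = D_L(w)`, `J' = D_R(w)`. If `Γ(1, w)` is
vertex-transitive, the orbit of `1` is the whole interval, so the content of the theorem is
`v(w) = w`. For this it suffices that each inversion of `w` lies either in a run of descending
consecutive positions or in a run of descending consecutive values (`sameBlock_of_inversion`).
Indeed, sorting the descending runs of positions then leaves an element of `W_J`, and comparing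
inversions gives `w = w₀(J) w₀(J ∩ J') w₀(J')` (`eq_longest_mul`). Moreover `w` then preserves the
initial segment `{1, …, k}` for each `k` outside `J ∪ J'`; full support forces `J ∪ J'` to be
everything, so `w` is nowhere almost reducible and `A_R(w) = A_L(w) = 1`.

An inversion violating the run condition produces one of the patterns `4231`, `3412`, `2341`, `4123`
in `w`. They are excluded as follows.

* Two neighbours `x t`, `x t'` of a vertex `x` have no common neighbours besides `x`, `x t t'` and
  `x t' t` (`common_neighbour`). At the top vertex `w` there always is a second common neighbour,
  hence by transitivity at every vertex. At a suitable vertex in the `𝔖₄`-coset of a pattern `4231`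
  or `3412` there is none (`avoids_4231`, `avoids_3412`).
* A pair of neighbours with three common neighbours spans a coset of type `𝔖₃`. A pattern `34521`
  gives at `w` three such cosets through the edge of the inversion `21`, no two of which are
  connected by a further one. At `1` this is impossible, because the set of transpositions below `w`
  is closed under passing to subintervals `[a, b]` (`avoids_34521`).
* Bruhat irreducibility says that for each inner letter `c` some letter below `c` is mapped above
  `c`, by `w` and by `w⁻¹` (`BruhatIrreducible.exists_lt_apply`). Counting entries around an extremal
  pattern `2341` then produces one of the patterns already excluded (`avoids_2341`). The pattern
  `4123` is a pattern `2341` of `w⁻¹`, and `Γ(1, w⁻¹)` is isomorphic to `Γ(1, w)`.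
-/

namespace BruhatOrbit

open Equiv

variable {n : ℕ}

/-! ### Length and inversions -/

/-- The inversions of `x`, as pairs of positions. -/
def inversions (x : Perm (Fin n)) : Finset (Fin n × Fin n) :=
  Finset.univ.filter fun p ↦ p.1 < p.2 ∧ x p.2 < x p.1

theorem mem_inversions {x : Perm (Fin n)} {p q : Fin n} :
    (p, q) ∈ inversions x ↔ p < q ∧ x q < x p := by
  rw [inversions, Finset.mem_filter]
  simp

theorem swap_lt_swap_iff {a b p q : Fin n} (hab : b.1 = a.1 + 1) (h : ¬ (p = a ∧ q = b))
    (h' : ¬ (p = b ∧ q = a)) : swap a b p < swap a b q ↔ p < q := by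
  simp only [Fin.ext_iff] at h h'
  simp only [swap_apply_def, Fin.ext_iff, Fin.lt_def]
  split_ifs <;> omega

theorem card_inversions_mul_swap {x : Perm (Fin n)} {a b : Fin n} (hab : b.1 = a.1 + 1)
    (hx : x a < x b) : (inversions (x * swap a b)).card = (inversions x).card + 1 := by
  have hlt : a < b := by simp only [Fin.lt_def]; omega
  have hne : a ≠ b := hlt.ne
  set f : Fin n × Fin n ↪ Fin n × Fin n :=
    ((swap a b).prodCongr (swap a b)).toEmbedding with hf
  have hmem : ∀ p q, (p, q) ∈ (inversions x).map f ↔ (swap a b p, swap a b q) ∈ inversions x := by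
    intro p q
    rw [hf, Finset.mem_map_equiv]
    simp
  have hnot : (a, b) ∉ (inversions x).map f := by
    rw [hmem]
    simp [mem_inversions, hlt.le]
  rw [← Finset.card_map (s := inversions x) f, ← Finset.card_insert_of_notMem hnot]
  congr 1
  ext ⟨p, q⟩
  rw [Finset.mem_insert, hmem]
  by_cases h1 : p = a ∧ q = b
  · obtain ⟨rfl, rfl⟩ := h1
    simp [mem_inversions, hlt, hx]
  by_cases h2 : p = b ∧ q = a
  · obtain ⟨rfl, rfl⟩ := h2
    simp [mem_inversions, hne, hx.le]
  simp [mem_inversions, swap_lt_swap_iff hab h1 h2, Prod.ext_iff, h1]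

theorem card_inversions_mul_swap_of_gt {x : Perm (Fin n)} {a b : Fin n} (hab : b.1 = a.1 + 1)
    (hx : x b < x a) : (inversions (x * swap a b)).card + 1 = (inversions x).card := by
  have := card_inversions_mul_swap (x := x * swap a b) hab (by simpa using hx)
  simpa [mul_assoc] using this.symm

theorem eq_one_of_strictMono {x : Perm (Fin n)} (h : StrictMono x) : x = 1 := by
  have : (h.orderIsoOfSurjective x x.surjective) = OrderIso.refl _ := Subsingleton.elim _ _
  ext i
  simpa using congrArg Fin.val (congrArg (fun e : Fin n ≃o Fin n ↦ e i) this)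

theorem eq_one_of_adjacent {x : Perm (Fin n)}
    (h : ∀ a b : Fin n, b.1 = a.1 + 1 → x a < x b) : x = 1 := by
  apply eq_one_of_strictMono
  intro a b hab
  obtain ⟨b, hb⟩ := b
  induction b with
  | zero => exact absurd hab (by simp [Fin.lt_def])
  | succ b ih =>
    have h1 := h ⟨b, by omega⟩ ⟨b + 1, hb⟩ rfl
    rcases (Nat.lt_succ_iff_lt_or_eq.1 (Fin.lt_def.1 hab)) with h2 | h2
    · exact (ih (by omega) h2).trans h1
    · have : a = ⟨b, by omega⟩ := Fin.ext h2
      rwa [this]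

theorem wordProd_append (l l' : List (Fin (n - 1))) :
    wordProd (l ++ l') = wordProd l * wordProd l' := by simp [wordProd]

theorem wordProd_singleton (i : Fin (n - 1)) : wordProd [i] = simple i := by simp [wordProd]

theorem length_mul_simple_le (x : Perm (Fin n)) (i : Fin (n - 1)) :
    length (x * simple i) ≤ length x + 1 := by
  obtain ⟨l, rfl, hl⟩ := exists_reducedWord x
  have := length_wordProd_le (l ++ [i])
  rw [wordProd_append, wordProd_singleton] at this
  simpa [hl] using this

theorem card_inversions_wordProd_le (l : List (Fin (n - 1))) :
    (inversions (wordProd l)).card ≤ l.length := by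
  induction l using List.reverseRecOn with
  | nil =>
    have : inversions (1 : Perm (Fin n)) = ∅ := by
      ext ⟨p, q⟩
      simpa [mem_inversions] using fun h : p < q ↦ h.le
    simp [wordProd, this]
  | append_singleton l i ih =>
    rw [wordProd_append, wordProd_singleton, List.length_append, List.length_singleton]
    rcases lt_or_gt_of_ne ((wordProd l).injective.ne
      (show (⟨i.1, by omega⟩ : Fin n) ≠ ⟨i.1 + 1, by omega⟩ by simp [Fin.ext_iff])) with h | h
    · have := card_inversions_mul_swap rfl h
      rw [simple]; omega
    · have := card_inversions_mul_swap_of_gt rfl h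
      rw [simple]; omega

theorem length_eq_card_inversions (x : Perm (Fin n)) : length x = (inversions x).card := by
  apply le_antisymm
  · induction hk : (inversions x).card using Nat.strong_induction_on generalizing x with
    | _ k ih =>
    by_cases h : ∀ a b : Fin n, b.1 = a.1 + 1 → x a < x b
    · rw [eq_one_of_adjacent h]
      exact (length_wordProd_le []).trans (Nat.zero_le _)
    · push Not at h
      obtain ⟨a, b, hab, hx⟩ := h
      have hx' : x b < x a := lt_of_le_of_ne hx (x.injective.ne (by rintro rfl; omega))
      have h1 := card_inversions_mul_swap_of_gt hab hx'
      have h2 := ih _ (by omega) (x * swap a b) rfl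
      have h3 : simple (⟨a.1, by omega⟩ : Fin (n - 1)) = swap a b := by
        simp [simple, ← hab]
      have h4 := length_mul_simple_le (x * swap a b) ⟨a.1, by omega⟩
      rw [h3, mul_assoc, swap_mul_self, mul_one] at h4
      omega
  · obtain ⟨l, rfl, hl⟩ := exists_reducedWord x
    rw [← hl]
    exact card_inversions_wordProd_le l

/-- Right multiplication by a transposition increases the length as soon as it creates an
inversion. The induction on the distance of the two positions only uses adjacent
transpositions, by which the length changes by exactly one. -/
theorem length_lt_mul_swap {x : Perm (Fin n)} {p q : Fin n} (hpq : p < q) (hx : x p < x q) :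
    length x < length (x * swap p q) := by
  rw [length_eq_card_inversions, length_eq_card_inversions]
  induction hk : q.1 generalizing x q with
  | zero => rw [Fin.lt_def] at hpq; omega
  | succ k ih =>
    obtain ⟨r, hr⟩ : ∃ r : Fin n, q.1 = r.1 + 1 := ⟨⟨k, by omega⟩, hk⟩
    have hrq : r ≠ q := by rintro rfl; omega
    rcases eq_or_ne p r with rfl | hne
    · have := card_inversions_mul_swap hr hx
      omega
    · have hpr : p < r := by
        rw [Fin.lt_def] at hpq ⊢
        have := Fin.val_ne_of_ne hne
        omega
      have e : x * swap p q = x * swap r q * swap p r * swap r q := by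
        rw [swap_comm p q, ← swap_mul_swap_mul_swap hpr.ne hpq.ne]
        simp only [mul_assoc]
      have hlt := ih (x := x * swap r q) (q := r) hpr
        (by simpa [swap_apply_of_ne_of_ne hpr.ne hpq.ne] using hx) (by omega)
      rw [e]
      rcases lt_or_gt_of_ne (x.injective.ne hrq) with h | h
      · have h3 := card_inversions_mul_swap hr h
        rcases lt_or_gt_of_ne ((x * swap r q * swap p r).injective.ne hrq) with h' | h'
        · have := card_inversions_mul_swap hr h'
          omega
        · have := card_inversions_mul_swap_of_gt hr h'
          omega
      · have h3 := card_inversions_mul_swap_of_gt hr h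
        have := card_inversions_mul_swap (x := x * swap r q * swap p r) hr (by
          simpa [swap_apply_of_ne_of_ne hpr.ne hpq.ne,
            swap_apply_of_ne_of_ne hpq.ne' hrq.symm] using hx.trans h)
        omega

theorem isReflection_iff {t : Perm (Fin n)} :
    IsReflection t ↔ ∃ p q : Fin n, p < q ∧ t = swap p q := by
  constructor
  · rintro ⟨u, i, rfl⟩
    have e : u * simple i * u⁻¹ = swap (u ⟨i.1, by omega⟩) (u ⟨i.1 + 1, by omega⟩) := by
      rw [simple, mul_swap_eq_swap_mul, mul_inv_cancel_right]
    rw [e]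
    rcases lt_or_gt_of_ne (u.injective.ne
      (show (⟨i.1, by omega⟩ : Fin n) ≠ ⟨i.1 + 1, by omega⟩ by simp [Fin.ext_iff])) with h | h
    · exact ⟨_, _, h, rfl⟩
    · exact ⟨_, _, h, swap_comm _ _⟩
  · rintro ⟨p, q, hpq, rfl⟩
    have h2 : 1 < n := by have := Fin.lt_def.1 hpq; omega
    obtain ⟨c, hc⟩ := isConj_iff.1 (Perm.isConj_swap
      (show (⟨0, by omega⟩ : Fin n) ≠ ⟨1, h2⟩ by simp [Fin.ext_iff]) hpq.ne)
    exact ⟨c, ⟨0, by omega⟩, by rw [← hc]; rfl⟩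

theorem bruhatEdge_iff {x y : Perm (Fin n)} :
    BruhatEdge x y ↔ ∃ p q, p < q ∧ x p < x q ∧ y = x * swap p q := by
  constructor
  · rintro ⟨t, ht, rfl, hl⟩
    obtain ⟨p, q, hpq, rfl⟩ := isReflection_iff.1 ht
    refine ⟨p, q, hpq, ?_, rfl⟩
    by_contra h
    have h' : x q < x p := lt_of_le_of_ne (not_lt.1 h) (x.injective.ne hpq.ne')
    have := length_lt_mul_swap (x := x * swap p q) hpq (by simpa using h')
    rw [mul_assoc, swap_mul_self, mul_one] at this
    omega
  · rintro ⟨p, q, hpq, hx, rfl⟩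
    exact ⟨_, isReflection_iff.2 ⟨p, q, hpq, rfl⟩, rfl, length_lt_mul_swap hpq hx⟩

theorem mem_rightDescents {x : Perm (Fin n)} {i : Fin (n - 1)} :
    i ∈ rightDescents x ↔ x ⟨i.1 + 1, by omega⟩ < x ⟨i.1, by omega⟩ := by
  have hlt : (⟨i.1, by omega⟩ : Fin n) < ⟨i.1 + 1, by omega⟩ := by simp [Fin.lt_def]
  rw [rightDescents, Set.mem_ofPred_eq, simple]
  constructor
  · intro h
    by_contra h'
    have := length_lt_mul_swap hlt (lt_of_le_of_ne (not_lt.1 h') (x.injective.ne hlt.ne))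
    omega
  · intro h
    have := card_inversions_mul_swap_of_gt rfl h
    rw [length_eq_card_inversions, length_eq_card_inversions]
    omega

theorem card_inversions_inv (x : Perm (Fin n)) : (inversions x⁻¹).card = (inversions x).card := by
  refine Finset.card_bij' (fun p _ ↦ (x⁻¹ p.2, x⁻¹ p.1)) (fun p _ ↦ (x p.2, x p.1)) ?_ ?_ ?_ ?_ <;>
    simp +contextual [mem_inversions]

theorem length_inv (x : Perm (Fin n)) : length x⁻¹ = length x := by
  rw [length_eq_card_inversions, length_eq_card_inversions, card_inversions_inv]

theorem leftDescents_eq (x : Perm (Fin n)) : leftDescents x = rightDescents x⁻¹ := by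
  ext i
  have : (simple i)⁻¹ = simple i := by simp [simple]
  rw [leftDescents, rightDescents, Set.mem_ofPred_eq, Set.mem_ofPred_eq, length_inv,
    ← length_inv (simple i * x), mul_inv_rev, this]

/-! ### The Bruhat order -/

theorem bruhatEdge_mul_swap {x : Perm (Fin n)} {p q : Fin n} (hpq : p < q) (hx : x q < x p) :
    BruhatEdge (x * swap p q) x :=
  bruhatEdge_iff.2 ⟨p, q, hpq, by simpa using hx, by simp [mul_assoc]⟩

theorem BruhatLE.mul_swap {x w : Perm (Fin n)} (h : BruhatLE x w) {p q : Fin n} (hpq : p < q)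
    (hx : x q < x p) : BruhatLE (x * swap p q) w :=
  Relation.ReflTransGen.head (bruhatEdge_mul_swap hpq hx) h

theorem BruhatEdge.inv {x y : Perm (Fin n)} (h : BruhatEdge x y) : BruhatEdge x⁻¹ y⁻¹ := by
  obtain ⟨p, q, hpq, hx, rfl⟩ := bruhatEdge_iff.1 h
  exact bruhatEdge_iff.2 ⟨x p, x q, hx, by simpa using hpq, by
    rw [mul_inv_rev, swap_inv, mul_swap_eq_swap_mul]; simp⟩

theorem BruhatLE.inv {x y : Perm (Fin n)} (h : BruhatLE x y) : BruhatLE x⁻¹ y⁻¹ := by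
  induction h with
  | refl => exact .refl
  | tail _ h ih => exact .tail ih h.inv

/-- The positions of the entries `≥ b` of `x` among the first ones, up to position `a`. -/
def rankSet (x : Perm (Fin n)) (a b : Fin n) : Finset (Fin n) :=
  Finset.univ.filter fun i ↦ i ≤ a ∧ b ≤ x i

theorem mem_rankSet {x : Perm (Fin n)} {a b i : Fin n} :
    i ∈ rankSet x a b ↔ i ≤ a ∧ b ≤ x i := by
  rw [rankSet, Finset.mem_filter]
  simp

/-- The rank function of a permutation matrix, which is monotone for the Bruhat order. -/
def rank (x : Perm (Fin n)) (a b : Fin n) : ℕ :=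
  (rankSet x a b).card

theorem BruhatEdge.rank_le {x y : Perm (Fin n)} (h : BruhatEdge x y) (a b : Fin n) :
    rank x a b ≤ rank y a b := by
  obtain ⟨p, q, hpq, hx, rfl⟩ := bruhatEdge_iff.1 h
  rcases le_or_gt q a with hqa | hqa
  · refine Finset.card_le_card_of_injOn (swap p q) ?_ (swap p q).injective.injOn
    intro i hi
    rw [SetLike.mem_coe, mem_rankSet] at hi ⊢
    refine ⟨?_, by simpa using hi.2⟩
    rw [swap_apply_def]
    split_ifs
    exacts [hqa, (hpq.trans_le hqa).le, hi.1]
  · refine Finset.card_le_card fun i hi ↦ ?_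
    rw [mem_rankSet] at hi ⊢
    rw [Perm.mul_apply]
    refine ⟨hi.1, hi.2.trans ?_⟩
    rw [swap_apply_def]
    split_ifs with h1 h2
    · rw [h1]; exact hx.le
    · exact absurd hi.1 (h2 ▸ hqa.not_ge)
    · exact le_rfl

theorem BruhatLE.rank_le {x y : Perm (Fin n)} (h : BruhatLE x y) (a b : Fin n) :
    rank x a b ≤ rank y a b := by
  induction h with
  | refl => exact le_rfl
  | tail _ h ih => exact ih.trans (h.rank_le a b)

/-- If the positions counted by `rank y a b` are among those counted by `rank x a b`, and `j` is a
further one of the latter, then `x ≤ y` fails. -/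
theorem not_bruhatLE {x y : Perm (Fin n)} (a b : Fin n) (h : ∀ i ≤ a, b ≤ y i → b ≤ x i)
    (j : Fin n) (hj : j ≤ a) (hx : b ≤ x j) (hy : y j < b) : ¬ BruhatLE x y := by
  intro hxy
  refine (hxy.rank_le a b).not_gt (Finset.card_lt_card ?_)
  rw [Finset.ssubset_iff_of_subset fun i hi ↦ ?_]
  · exact ⟨j, by simp [mem_rankSet, hj, hx], by simp [mem_rankSet, hy]⟩
  · rw [mem_rankSet] at hi ⊢
    exact ⟨hi.1, h i hi.1 hi.2⟩

theorem mem_interval {x w : Perm (Fin n)} : x ∈ bruhatInterval 1 w ↔ BruhatLE x w :=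
  ⟨fun h ↦ h.2, fun h ↦ ⟨one_bruhatLE x, h⟩⟩

theorem bruhatEdge_or {x : Perm (Fin n)} {p q : Fin n} (h : p ≠ q) :
    BruhatEdge x (x * swap p q) ∨ BruhatEdge (x * swap p q) x := by
  wlog hpq : p < q generalizing p q
  · rw [swap_comm]
    exact this h.symm (lt_of_le_of_ne (not_lt.1 hpq) h.symm)
  rcases lt_or_gt_of_ne (x.injective.ne h) with hx | hx
  · exact .inl (bruhatEdge_iff.2 ⟨p, q, hpq, hx, rfl⟩)
  · exact .inr (bruhatEdge_mul_swap hpq hx)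

theorem BruhatEdge.ne {x y : Perm (Fin n)} (h : BruhatEdge x y) : x ≠ y := by
  obtain ⟨_, _, _, h⟩ := h
  rintro rfl
  exact h.ne rfl

theorem intervalGraph_adj {w : Perm (Fin n)} {x y : bruhatInterval 1 w} :
    (intervalGraph 1 w).Adj x y ↔ ∃ p q, p ≠ q ∧ y.1 = x.1 * swap p q := by
  have : (intervalGraph 1 w).Adj x y ↔ x.1 ≠ y.1 ∧ (BruhatEdge x.1 y.1 ∨ BruhatEdge y.1 x.1) := by
    simp [intervalGraph, bruhatGraph]
  rw [this]
  constructor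
  · rintro ⟨-, h | h⟩ <;> obtain ⟨p, q, hpq, -, h⟩ := bruhatEdge_iff.1 h
    · exact ⟨p, q, hpq.ne, h⟩
    · exact ⟨p, q, hpq.ne, by simp [h, mul_assoc]⟩
  · rintro ⟨p, q, hpq, h⟩
    have := bruhatEdge_or (x := x.1) hpq
    rw [← h] at this
    exact ⟨this.elim (·.ne) (·.ne.symm), this⟩

/-- A neighbour of the top element `w` lies below it, i.e. comes from an inversion. -/
theorem lt_of_mul_swap_bruhatLE {w : Perm (Fin n)} {p q : Fin n} (hpq : p < q)
    (h : BruhatLE (w * swap p q) w) : w q < w p := by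
  by_contra hw
  have h' : w p < w q := lt_of_le_of_ne (not_lt.1 hw) (w.injective.ne hpq.ne)
  refine not_bruhatLE p (w q) (fun i hi hwi ↦ ?_) p le_rfl (by simp) h' h
  have hip : i ≠ p := by rintro rfl; exact hwi.not_gt h'
  rwa [Perm.mul_apply, swap_apply_of_ne_of_ne hip (hi.trans_lt hpq).ne]

/-! ### Common neighbours -/

theorem apply_ne_of_swap_mul_swap {α : Type*} [DecidableEq α] {g : Perm α} {a b c d : α}
    (hab : a ≠ b) (hg : g = swap c d * swap a b) (h1 : g ≠ 1) : g a ≠ a := by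
  intro h
  have h2 : swap c d b = a := by simpa [hg] using h
  have : swap c d = swap a b := by
    rw [swap_apply_def] at h2
    split_ifs at h2 with h3 h4
    · rw [← h2, h3, swap_comm]
    · rw [← h2, h4]
    · exact absurd h2.symm hab
  exact h1 (by rw [hg, this, swap_mul_self])

theorem apply_eq_or_of_swap_mul_swap {α : Type*} [DecidableEq α] {g : Perm α} {a b c d : α}
    (hab : a ≠ b) (hg : g = swap c d * swap a b) (h1 : g ≠ 1) : g a = b ∨ g b = a := by
  by_contra! h
  have ha : swap c d b ≠ b := by simpa [hg] using h.1
  have hb : swap c d a ≠ a := by simpa [hg] using h.2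
  have : swap c d = swap a b := by
    have ha' := swap_apply_ne_self_iff.1 ha
    have hb' := swap_apply_ne_self_iff.1 hb
    rcases ha'.2 with rfl | rfl <;> rcases hb'.2 with rfl | rfl
    · exact absurd rfl hab
    · exact swap_comm _ _
    · rfl
    · exact absurd rfl hab
  exact h1 (by rw [hg, this, swap_mul_self])

theorem swap_mul_swap_rotate {α : Type*} [DecidableEq α] {a b c : α} (hac : a ≠ c) (hbc : b ≠ c) :
    swap a b * swap a c = swap c b * swap a b := by
  rw [mul_swap_eq_swap_mul, swap_apply_left, swap_apply_of_ne_of_ne hac.symm hbc.symm, swap_comm b c]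

/-- Two elements `x t` and `x t'` have, besides `x`, no common neighbours other than `x t t'` and
`x t' t`. -/
theorem common_neighbour {α : Type*} [DecidableEq α] {a b c d e f g h : α}
    (hab : a ≠ b) (hcd : c ≠ d) (hef : e ≠ f) (hne : swap a b ≠ swap c d)
    (heq : swap a b * swap e f = swap c d * swap g h) (h1 : swap a b * swap e f ≠ 1) :
    swap a b * swap e f = swap a b * swap c d ∨ swap a b * swap e f = swap c d * swap a b := by
  have hG : swap c d * swap a b = swap g h * swap e f := by
    have := congrArg (fun x ↦ swap c d * x * swap e f) heq
    simpa [mul_assoc] using this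
  have hG1 : swap c d * swap a b ≠ 1 := by
    intro h2
    exact hne (by simpa using (mul_eq_one_iff_eq_inv.1 h2).symm)
  have hmem : ∀ u, (swap c d * swap a b) u ≠ u → (u = a ∨ u = b) ∨ (u = c ∨ u = d) := by
    intro u hu
    by_contra! hu'
    exact hu (by simp [swap_apply_of_ne_of_ne, hu'])
  have hne1 : swap a b ≠ swap e f := by
    intro h2
    exact h1 (by rw [h2, swap_mul_self])
  -- a transposition which moves one point of each of the two given ones
  have key : ∀ a b c d e f g h : α, a ≠ b → c ≠ d → e ≠ f → swap a b ≠ swap e f →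
      swap c d * swap a b = swap g h * swap e f → swap c d * swap a b ≠ 1 → e = a → f = c →
      swap a b * swap e f = swap a b * swap c d ∨
        swap a b * swap e f = swap c d * swap a b := by
    rintro a b c d e f g h hab hcd hef hne1 hG hG1 rfl rfl
    by_cases h3 : e = d
    · exact .inl (by rw [h3, swap_comm d f])
    by_cases h4 : b = f
    · exact absurd (by rw [h4]) hne1
    by_cases h5 : b = d
    · right
      rw [swap_mul_swap_rotate hef h4, h5]
    · exfalso
      rcases apply_eq_or_of_swap_mul_swap hef hG hG1 with h6 | h6
      · rw [Perm.mul_apply, swap_apply_left, swap_apply_of_ne_of_ne h4 h5] at h6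
        exact h4 h6
      · rw [Perm.mul_apply, swap_apply_of_ne_of_ne hef.symm (Ne.symm h4), swap_apply_left] at h6
        exact h3 h6.symm
  have key' : ∀ e f : α, e ≠ f → swap a b ≠ swap e f →
      swap c d * swap a b = swap g h * swap e f → (e = a ∨ e = b) → (f = c ∨ f = d) →
      swap a b * swap e f = swap a b * swap c d ∨
        swap a b * swap e f = swap c d * swap a b := by
    intro e f hef hne1 hG he hf
    rcases he with he | he <;> rcases hf with hf | hf
    · exact key a b c d e f g h hab hcd hef hne1 hG hG1 he hf
    · have := key a b d c e f g h hab hcd.symm hef hne1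
      rw [swap_comm d c] at this
      exact this hG hG1 he hf
    · have := key b a c d e f g h hab.symm hcd hef
      rw [swap_comm b a] at this
      exact this hne1 hG hG1 he hf
    · have := key b a d c e f g h hab.symm hcd.symm hef
      rw [swap_comm d c, swap_comm b a] at this
      exact this hne1 hG hG1 he hf
  rcases hmem e (apply_ne_of_swap_mul_swap hef hG hG1) with he | he <;>
    rcases hmem f (apply_ne_of_swap_mul_swap hef.symm (swap_comm e f ▸ hG) hG1) with hf | hf
  · refine absurd ?_ hne1
    rcases he with rfl | rfl <;> rcases hf with rfl | rfl
    exacts [absurd rfl hef, rfl, swap_comm _ _, absurd rfl hef]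
  · exact key' e f hef hne1 hG he hf
  · have := key' f e hef.symm
    rw [swap_comm f e] at this
    exact this hne1 hG hf he
  · left
    congr 1
    rcases he with rfl | rfl <;> rcases hf with rfl | rfl
    exacts [absurd rfl hef, rfl, swap_comm _ _, absurd rfl hef]

/-! ### Consequences of vertex-transitivity -/

theorem eq_or_eq_of_common_neighbour {x z : Perm (Fin n)} {a b c d e f g h : Fin n}
    (hab : a ≠ b) (hcd : c ≠ d) (hef : e ≠ f) (hne : swap a b ≠ swap c d)
    (h1 : z = x * swap a b * swap e f) (h2 : z = x * swap c d * swap g h) (hz : z ≠ x) :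
    z = x * swap a b * swap c d ∨ z = x * swap c d * swap a b := by
  rw [h1, mul_assoc] at hz h2 ⊢
  rw [mul_assoc, mul_right_inj] at h2
  exact (common_neighbour hab hcd hef hne h2 fun h ↦ hz (by rw [h, mul_one])).imp
    (fun h ↦ by rw [h, mul_assoc]) (fun h ↦ by rw [h, mul_assoc])

theorem mul_swap_mul_eq (x t : Perm (Fin n)) (p q : Fin n) :
    x * swap p q * t = x * t * swap (t⁻¹ p) (t⁻¹ q) := by
  rw [mul_assoc, swap_mul_eq_mul_swap, mul_assoc]

/-- Two inversions of `w` are completed to a square below `w`. -/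
theorem bruhatLE_mul_swap_mul_swap {w : Perm (Fin n)} {p q p' q' : Fin n} (hpq : p < q)
    (hpq' : p' < q') (h : w q < w p) (h' : w q' < w p') (hne : swap p q ≠ swap p' q') :
    BruhatLE (w * swap p q * swap p' q') w ∨ BruhatLE (w * swap p' q' * swap p q) w := by
  by_cases h1 : (w * swap p q) q' < (w * swap p q) p'
  · exact .inl ((BruhatLE.mul_swap .refl hpq h).mul_swap hpq' h1)
  · refine .inr ((BruhatLE.mul_swap .refl hpq' h').mul_swap hpq ?_)
    have hi := w.injective
    rw [Perm.mul_apply, Perm.mul_apply] at h1 ⊢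
    have : ¬ (p = p' ∧ q = q') := by rintro ⟨rfl, rfl⟩; exact hne rfl
    have hi' : w q = w q' → q = q' := fun h ↦ hi h
    have hi'' : w p = w p' → p = p' := fun h ↦ hi h
    rw [swap_apply_def, swap_apply_def] at h1 ⊢
    grind

theorem exists_second_common_neighbour {w : Perm (Fin n)}
    (hvt : IsVertexTransitive (intervalGraph 1 w)) {x y y' : bruhatInterval 1 w}
    (hy : (intervalGraph 1 w).Adj x y) (hy' : (intervalGraph 1 w).Adj x y') (hne : y ≠ y') :
    ∃ z ≠ x, (intervalGraph 1 w).Adj y z ∧ (intervalGraph 1 w).Adj y' z := by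
  wlog hx : x.1 = w generalizing x y y'
  · obtain ⟨φ, hφ⟩ := hvt x ⟨w, mem_interval.2 .refl⟩
    obtain ⟨z, hz, h, h'⟩ := this (φ.map_adj_iff.2 hy) (φ.map_adj_iff.2 hy')
      (φ.injective.ne hne) (by rw [hφ])
    refine ⟨φ.symm z, fun h ↦ hz (by rw [← h]; simp), ?_, ?_⟩
    · rw [← φ.map_adj_iff]; simpa using h
    · rw [← φ.map_adj_iff]; simpa using h'
  have key : ∀ {y : bruhatInterval 1 w}, (intervalGraph 1 w).Adj x y →
      ∃ p q, p < q ∧ w q < w p ∧ y.1 = w * swap p q := by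
    intro y hy
    obtain ⟨p, q, hpq, h⟩ := intervalGraph_adj.1 hy
    wlog hlt : p < q generalizing p q
    · exact this q p hpq.symm (by rw [h, swap_comm]) (lt_of_le_of_ne (not_lt.1 hlt) hpq.symm)
    rw [hx] at h
    exact ⟨p, q, hlt, lt_of_mul_swap_bruhatLE hlt (h ▸ mem_interval.1 y.2), h⟩
  obtain ⟨p, q, hpq, h, e⟩ := key hy
  obtain ⟨p', q', hpq', h', e'⟩ := key hy'
  have hsw : swap p q ≠ swap p' q' := fun h ↦ hne (Subtype.ext (by rw [e, e', h]))
  have hne1 : swap p q * swap p' q' ≠ 1 := fun h ↦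
    hsw (by simpa using mul_eq_one_iff_eq_inv.1 h)
  have hne2 : swap p' q' * swap p q ≠ 1 := fun h ↦
    hsw (by simpa using (mul_eq_one_iff_eq_inv.1 h).symm)
  rcases bruhatLE_mul_swap_mul_swap hpq hpq' h h' hsw with hz | hz
  · refine ⟨⟨_, mem_interval.2 hz⟩, fun h ↦ hne1 ?_, intervalGraph_adj.2 ⟨p', q', hpq'.ne, ?_⟩,
      intervalGraph_adj.2 ⟨_, _, (swap p' q')⁻¹.injective.ne hpq.ne, ?_⟩⟩
    · have := congrArg Subtype.val h
      rw [hx] at this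
      simpa [mul_assoc] using this
    · rw [e]
    · rw [e']; exact mul_swap_mul_eq _ _ _ _
  · refine ⟨⟨_, mem_interval.2 hz⟩, fun h ↦ hne2 ?_,
      intervalGraph_adj.2 ⟨_, _, (swap p q)⁻¹.injective.ne hpq'.ne, ?_⟩,
      intervalGraph_adj.2 ⟨p, q, hpq.ne, ?_⟩⟩
    · have := congrArg Subtype.val h
      rw [hx] at this
      simpa [mul_assoc] using this
    · rw [e]; exact mul_swap_mul_eq _ _ _ _
    · rw [e']

theorem bruhatLE_or_of_neighbours {w : Perm (Fin n)}
    (hvt : IsVertexTransitive (intervalGraph 1 w)) {x : Perm (Fin n)} {a b c d : Fin n}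
    (hab : a ≠ b) (hcd : c ≠ d) (hne : swap a b ≠ swap c d) (hx : BruhatLE x w)
    (h : BruhatLE (x * swap a b) w) (h' : BruhatLE (x * swap c d) w) :
    BruhatLE (x * swap a b * swap c d) w ∨ BruhatLE (x * swap c d * swap a b) w := by
  obtain ⟨z, hz, h1, h2⟩ := exists_second_common_neighbour hvt (x := ⟨x, mem_interval.2 hx⟩)
    (y := ⟨_, mem_interval.2 h⟩) (y' := ⟨_, mem_interval.2 h'⟩)
    (intervalGraph_adj.2 ⟨a, b, hab, rfl⟩) (intervalGraph_adj.2 ⟨c, d, hcd, rfl⟩)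
    (fun h ↦ hne (by simpa using congrArg Subtype.val h))
  obtain ⟨e, f, hef, e1⟩ := intervalGraph_adj.1 h1
  obtain ⟨g, k, -, e2⟩ := intervalGraph_adj.1 h2
  have hzw := mem_interval.1 z.2
  rcases eq_or_eq_of_common_neighbour hab hcd hef hne e1 e2
    (fun h ↦ hz (Subtype.ext h)) with h3 | h3
  · exact .inl (h3 ▸ hzw)
  · exact .inr (h3 ▸ hzw)

theorem swap_ne_swap {α : Type*} [DecidableEq α] {a b c d : α} (hab : a ≠ b) (hac : a ≠ c)
    (had : a ≠ d) : swap a b ≠ swap c d := by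
  intro h
  have := congrArg (fun x : Perm α ↦ x a) h
  simp only [swap_apply_left, swap_apply_of_ne_of_ne hac had] at this
  exact hab this.symm

/-- Vertex-transitivity excludes the pattern `4231`: the square spanned by two commuting
transpositions at the bottom of the `𝔖₄`-coset of the pattern misses its fourth vertex `3412`. -/
theorem avoids_4231 {w : Perm (Fin n)} (hvt : IsVertexTransitive (intervalGraph 1 w))
    {a b c d : Fin n} (hab : a < b) (hbc : b < c) (hcd : c < d) (h1 : w d < w b) (h2 : w b < w c)
    (h3 : w c < w a) : False := by
  have hac := hab.trans hbc
  have hbd := hbc.trans hcd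
  have had := hab.trans hbd
  have s1 : BruhatLE (w * swap a d) w := .mul_swap .refl had (h1.trans (h2.trans h3))
  have r1 : BruhatLE (w * swap a c * swap c d) w :=
    BruhatLE.mul_swap (.mul_swap .refl hac h3) hcd (by
      simpa [swap_apply_of_ne_of_ne had.ne' hcd.ne'] using h1.trans (h2.trans h3))
  have r2 : BruhatLE (w * swap b d * swap a b) w :=
    BruhatLE.mul_swap (.mul_swap .refl hbd h1) hab (by
      simpa [swap_apply_of_ne_of_ne hab.ne had.ne] using h1.trans (h2.trans h3))
  have e1 : w * swap a c * swap c d = w * swap a d * swap a c := by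
    simp only [mul_assoc, mul_right_inj]
    ext i
    simp only [Perm.mul_apply, swap_apply_def]
    grind
  have e2 : w * swap b d * swap a b = w * swap a d * swap b d := by
    simp only [mul_assoc, mul_right_inj]
    ext i
    simp only [Perm.mul_apply, swap_apply_def]
    grind
  rw [e1] at r1
  rw [e2] at r2
  have h := bruhatLE_or_of_neighbours hvt hac.ne hbd.ne (swap_ne_swap hac.ne hab.ne had.ne) s1 r1 r2
  have e : w * swap a d * swap b d * swap a c = w * swap a d * swap a c * swap b d := by
    simp only [mul_assoc, mul_right_inj]
    ext i
    simp only [Perm.mul_apply, swap_apply_def]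
    grind
  rw [e, or_self] at h
  revert h
  refine not_bruhatLE b (w c) (fun i hi hwi ↦ ?_) b le_rfl ?_ h2
  · simp only [mul_assoc, Perm.mul_apply, swap_apply_def]
    grind
  · simp only [mul_assoc, Perm.mul_apply, swap_apply_def]
    grind

/-- Vertex-transitivity excludes the pattern `3412`: at the bottom of the `𝔖₄`-coset of the pattern,
the neighbours `3214` and `1243` have no second common neighbour, since the only candidates `3241`
and `4213` do not lie below `3412`. -/
theorem avoids_3412 {w : Perm (Fin n)} (hvt : IsVertexTransitive (intervalGraph 1 w))
    {a b c d : Fin n} (hab : a < b) (hbc : b < c) (hcd : c < d) (h1 : w c < w d) (h2 : w d < w a)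
    (h3 : w a < w b) : False := by
  have hac := hab.trans hbc
  have hbd := hbc.trans hcd
  have had := hab.trans hbd
  have s1 : BruhatLE (w * swap b d) w := .mul_swap .refl hbd (h2.trans h3)
  have s2 : BruhatLE (w * swap b d * swap a c) w := s1.mul_swap hac (by
    simpa [swap_apply_of_ne_of_ne hbc.ne' hcd.ne, swap_apply_of_ne_of_ne hab.ne had.ne]
      using h1.trans h2)
  have r1 : BruhatLE (w * swap a c) w := .mul_swap .refl hac (h1.trans h2)
  have r2 : BruhatLE (w * swap a c * swap b c) w := r1.mul_swap hbc (by
    simpa [swap_apply_of_ne_of_ne hab.ne' hbc.ne] using h3)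
  have r3 : BruhatLE (w * swap a c * swap b c * swap b d) w := r2.mul_swap hbd (by
    simpa [swap_apply_of_ne_of_ne hbd.ne' hcd.ne', swap_apply_of_ne_of_ne had.ne' hcd.ne']
      using h2)
  have e : w * swap a c * swap b c * swap b d = w * swap b d * swap a c * swap c d := by
    simp only [mul_assoc, mul_right_inj]
    ext i
    simp only [Perm.mul_apply, swap_apply_def]
    grind
  rw [e] at r3
  rcases bruhatLE_or_of_neighbours hvt hac.ne hcd.ne
    (swap_ne_swap hac.ne hac.ne had.ne) s2 (by simpa [mul_assoc] using s1) r3 with h | h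
  · revert h
    refine not_bruhatLE c (w d) (fun i hi hwi ↦ ?_) c le_rfl ?_ h1
    · simp only [mul_assoc, Perm.mul_apply, swap_apply_def]
      grind
    · simp only [mul_assoc, Perm.mul_apply, swap_apply_def]
      grind
  · revert h
    refine not_bruhatLE a (w b) (fun i hi hwi ↦ ?_) a le_rfl ?_ h3
    · simp only [mul_assoc, Perm.mul_apply, swap_apply_def]
      grind
    · simp only [mul_assoc, Perm.mul_apply, swap_apply_def]
      grind

/-! ### Books of triangles -/

section Book

variable {V W : Type*} {G : SimpleGraph V} {H : SimpleGraph W}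

/-- The vertices `y` and `y'` have at least two common neighbours other than `v`. -/
def TwoCommon (G : SimpleGraph V) (v y y' : V) : Prop :=
  ∃ z z', z ≠ z' ∧ z ≠ v ∧ z' ≠ v ∧ G.Adj y z ∧ G.Adj y' z ∧ G.Adj y z' ∧ G.Adj y' z'

/-- Three distinct neighbours of `v` have two common neighbours other than `v`. In a Bruhat graph
this means that `v` and these neighbours lie on a common coset of a reflection subgroup
isomorphic to `𝔖₃`, which is contained in the graph. -/
def IsTriangle (G : SimpleGraph V) (v y₁ y₂ y₃ : V) : Prop :=
  (y₁ ≠ y₂ ∧ y₁ ≠ y₃ ∧ y₂ ≠ y₃) ∧ (G.Adj v y₁ ∧ G.Adj v y₂ ∧ G.Adj v y₃) ∧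
  ∃ z z', z ≠ z' ∧ z ≠ v ∧ z' ≠ v ∧ (G.Adj y₁ z ∧ G.Adj y₂ z ∧ G.Adj y₃ z) ∧
    (G.Adj y₁ z' ∧ G.Adj y₂ z' ∧ G.Adj y₃ z')

/-- A book of three triangles at `v`: the triangles share the spine `f`, and no further triangle
connects edges of two different pages. -/
def HasBook (G : SimpleGraph V) (v : V) : Prop :=
  ∃ (f : V) (g : Fin 3 → Bool → V), (∀ i, IsTriangle G v f (g i false) (g i true)) ∧
    ∀ i j, i ≠ j → ∀ s t, ¬ TwoCommon G v (g i s) (g j t)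

theorem TwoCommon.map (φ : G ≃g H) {v y y' : V} (h : TwoCommon G v y y') :
    TwoCommon H (φ v) (φ y) (φ y') := by
  obtain ⟨z, z', h1, h2, h3, h4, h5, h6, h7⟩ := h
  exact ⟨φ z, φ z', φ.injective.ne h1, φ.injective.ne h2, φ.injective.ne h3,
    φ.map_adj_iff.2 h4, φ.map_adj_iff.2 h5, φ.map_adj_iff.2 h6, φ.map_adj_iff.2 h7⟩

theorem IsTriangle.map (φ : G ≃g H) {v y₁ y₂ y₃ : V} (h : IsTriangle G v y₁ y₂ y₃) :
    IsTriangle H (φ v) (φ y₁) (φ y₂) (φ y₃) := by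
  obtain ⟨⟨a, b, c⟩, ⟨d, e, f⟩, z, z', h1, h2, h3, ⟨h4, h5, h6⟩, h7, h8, h9⟩ := h
  exact ⟨⟨φ.injective.ne a, φ.injective.ne b, φ.injective.ne c⟩,
    ⟨φ.map_adj_iff.2 d, φ.map_adj_iff.2 e, φ.map_adj_iff.2 f⟩,
    φ z, φ z', φ.injective.ne h1, φ.injective.ne h2, φ.injective.ne h3,
    ⟨φ.map_adj_iff.2 h4, φ.map_adj_iff.2 h5, φ.map_adj_iff.2 h6⟩,
    φ.map_adj_iff.2 h7, φ.map_adj_iff.2 h8, φ.map_adj_iff.2 h9⟩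

theorem HasBook.map (φ : G ≃g H) {v : V} (h : HasBook G v) : HasBook H (φ v) := by
  obtain ⟨f, g, h1, h2⟩ := h
  refine ⟨φ f, fun i s ↦ φ (g i s), fun i ↦ (h1 i).map φ, fun i j hij s t h ↦ h2 i j hij s t ?_⟩
  simpa using h.map φ.symm

theorem IsTriangle.twoCommon {v y₁ y₂ y₃ : V} (h : IsTriangle G v y₁ y₂ y₃) :
    TwoCommon G v y₁ y₂ ∧ TwoCommon G v y₂ y₂ ∧ TwoCommon G v y₃ y₃ := by
  obtain ⟨-, -, z, z', h1, h2, h3, ⟨h4, h5, h6⟩, h7, h8, h9⟩ := h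
  exact ⟨⟨z, z', h1, h2, h3, h4, h5, h7, h8⟩, ⟨z, z', h1, h2, h3, h5, h5, h8, h8⟩,
    ⟨z, z', h1, h2, h3, h6, h6, h9, h9⟩⟩

end Book

theorem isTriangle_of_bruhatLE {w : Perm (Fin n)} {x y y' y'' : bruhatInterval 1 w} {a b c : Fin n}
    (hab : a ≠ b) (hac : a ≠ c) (hbc : b ≠ c) (hy : y.1 = x.1 * swap a b)
    (hy' : y'.1 = x.1 * swap a c) (hy'' : y''.1 = x.1 * swap b c)
    (h : BruhatLE (x.1 * swap a b * swap a c) w) (h' : BruhatLE (x.1 * swap a c * swap a b) w) :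
    IsTriangle (intervalGraph 1 w) x y y' y'' := by
  have n1 : swap a b ≠ swap a c := by
    rw [swap_comm a b]; exact swap_ne_swap hab.symm hab.symm hbc
  have n2 : swap a b ≠ swap b c := swap_ne_swap hab hab hac
  have n3 : swap a c ≠ swap b c := swap_ne_swap hac hab hac
  have hinj : ∀ {u v : Perm (Fin n)}, u ≠ v → x.1 * u ≠ x.1 * v := fun h h' ↦
    h (mul_left_cancel h')
  have e1 : swap a b * swap a c = swap a c * swap b c := by
    ext i; simp only [Perm.mul_apply, swap_apply_def]; grind
  have e2 : swap a b * swap a c = swap b c * swap a b := by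
    ext i; simp only [Perm.mul_apply, swap_apply_def]; grind
  have e3 : swap a c * swap a b = swap a b * swap b c := by
    ext i; simp only [Perm.mul_apply, swap_apply_def]; grind
  have e4 : swap a c * swap a b = swap b c * swap a c := by
    ext i; simp only [Perm.mul_apply, swap_apply_def]; grind
  have v1 : (swap a b * swap a c) a = c := by
    simp [swap_apply_of_ne_of_ne hac.symm hbc.symm]
  have v2 : (swap a c * swap a b) a = b := by
    simp [swap_apply_of_ne_of_ne hab.symm hbc]
  obtain ⟨z, hz⟩ : ∃ z : bruhatInterval 1 w, z.1 = x.1 * (swap a b * swap a c) :=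
    ⟨⟨_, mem_interval.2 h⟩, mul_assoc _ _ _⟩
  obtain ⟨z', hz'⟩ : ∃ z : bruhatInterval 1 w, z.1 = x.1 * (swap a c * swap a b) :=
    ⟨⟨_, mem_interval.2 h'⟩, mul_assoc _ _ _⟩
  refine ⟨⟨?_, ?_, ?_⟩, ⟨intervalGraph_adj.2 ⟨a, b, hab, hy⟩, intervalGraph_adj.2 ⟨a, c, hac, hy'⟩,
    intervalGraph_adj.2 ⟨b, c, hbc, hy''⟩⟩, z, z',
    ?_, ?_, ?_,
    ⟨intervalGraph_adj.2 ⟨a, c, hac, ?_⟩, intervalGraph_adj.2 ⟨b, c, hbc, ?_⟩,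
      intervalGraph_adj.2 ⟨a, b, hab, ?_⟩⟩,
    ⟨intervalGraph_adj.2 ⟨b, c, hbc, ?_⟩, intervalGraph_adj.2 ⟨a, b, hab, ?_⟩,
      intervalGraph_adj.2 ⟨a, c, hac, ?_⟩⟩⟩
  · rw [Ne, Subtype.ext_iff, hy, hy']; exact hinj n1
  · rw [Ne, Subtype.ext_iff, hy, hy'']; exact hinj n2
  · rw [Ne, Subtype.ext_iff, hy', hy'']; exact hinj n3
  · rw [Ne, Subtype.ext_iff, hz, hz']
    exact hinj fun h ↦ hbc (v2.symm.trans
      ((congrArg (fun u : Perm (Fin n) ↦ u a) h.symm).trans v1))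
  · rw [Ne, Subtype.ext_iff, hz, mul_eq_left]
    exact fun h ↦ hac (by rw [← v1, h]; rfl)
  · rw [Ne, Subtype.ext_iff, hz', mul_eq_left]
    exact fun h ↦ hab (by rw [← v2, h]; rfl)
  · rw [hz, hy, mul_assoc]
  · rw [hz, hy', mul_assoc, e1]
  · rw [hz, hy'', mul_assoc, e2]
  · rw [hz', hy, mul_assoc, e3]
  · rw [hz', hy', mul_assoc]
  · rw [hz', hy'', mul_assoc, e4]

/-- If the neighbours `x t` and `x t'` of `x` have two further common neighbours, then both
`x t t'` and `x t' t` belong to the graph, and they differ. -/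
theorem TwoCommon.bruhatLE {w : Perm (Fin n)} {x y y' : bruhatInterval 1 w} {a b c d : Fin n}
    (hab : a ≠ b) (hcd : c ≠ d) (hne : swap a b ≠ swap c d) (hy : y.1 = x.1 * swap a b)
    (hy' : y'.1 = x.1 * swap c d) (h : TwoCommon (intervalGraph 1 w) x y y') :
    BruhatLE (x.1 * swap a b * swap c d) w ∧ BruhatLE (x.1 * swap c d * swap a b) w ∧
      swap a b * swap c d ≠ swap c d * swap a b := by
  obtain ⟨z, z', hzz, hz, hz', h1, h2, h3, h4⟩ := h
  have key : ∀ z : bruhatInterval 1 w, z ≠ x → (intervalGraph 1 w).Adj y z →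
      (intervalGraph 1 w).Adj y' z → z.1 = x.1 * swap a b * swap c d ∨
      z.1 = x.1 * swap c d * swap a b := by
    intro z hz h1 h2
    obtain ⟨e, f, hef, e1⟩ := intervalGraph_adj.1 h1
    obtain ⟨g, k, -, e2⟩ := intervalGraph_adj.1 h2
    rw [hy] at e1
    rw [hy'] at e2
    exact eq_or_eq_of_common_neighbour hab hcd hef hne e1 e2 fun h ↦ hz (Subtype.ext h)
  have hzw := mem_interval.1 z.2
  have hzw' := mem_interval.1 z'.2
  have hzz' : z.1 ≠ z'.1 := fun h ↦ hzz (Subtype.ext h)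
  rcases key z hz h1 h2 with e | e <;> rcases key z' hz' h3 h4 with e' | e' <;> rw [e] at hzw hzz'
    <;> rw [e'] at hzw' hzz'
  · exact absurd rfl hzz'
  · exact ⟨hzw, hzw', fun h ↦ hzz' (by rw [mul_assoc, h, mul_assoc])⟩
  · exact ⟨hzw', hzw, fun h ↦ hzz' (by rw [mul_assoc, ← h, mul_assoc])⟩
  · exact absurd rfl hzz'

/-- A triangle at `1` consists of the three transpositions of three letters. -/
theorem IsTriangle.exists_third {w : Perm (Fin n)} {x y₁ y₂ y₃ : bruhatInterval 1 w} {a b : Fin n}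
    (hx : x.1 = 1) (hab : a ≠ b) (hy₁ : y₁.1 = swap a b)
    (h : IsTriangle (intervalGraph 1 w) x y₁ y₂ y₃) :
    ∃ c, c ≠ a ∧ c ≠ b ∧ ((y₂.1 = swap a c ∧ y₃.1 = swap b c) ∨
      (y₂.1 = swap b c ∧ y₃.1 = swap a c)) := by
  have h0 := h
  obtain ⟨⟨h12, h13, h23⟩, ⟨-, a2, a3⟩, z, -, -, hz, -, ⟨z1, z2, z3⟩, -⟩ := h
  obtain ⟨c, d, hcd, e2⟩ := intervalGraph_adj.1 a2
  obtain ⟨e, f, hef, e3⟩ := intervalGraph_adj.1 a3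
  rw [hx, one_mul] at e2 e3
  have n12 : swap a b ≠ swap c d := by rw [← hy₁, ← e2]; exact fun h ↦ h12 (Subtype.ext h)
  have n13 : swap a b ≠ swap e f := by rw [← hy₁, ← e3]; exact fun h ↦ h13 (Subtype.ext h)
  have n23 : swap c d ≠ swap e f := by rw [← e2, ← e3]; exact fun h ↦ h23 (Subtype.ext h)
  obtain ⟨-, -, hcomm⟩ := h0.twoCommon.1.bruhatLE hab hcd n12 (by rw [hx, one_mul, hy₁])
    (by rw [hx, one_mul, e2])
  have key : ∀ {c d : Fin n} {y : bruhatInterval 1 w}, c ≠ d → swap a b ≠ swap c d →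
      y.1 = swap c d → (intervalGraph 1 w).Adj y z →
      z.1 = swap a b * swap c d ∨ z.1 = swap c d * swap a b := by
    intro c d y hcd hne hy hyz
    obtain ⟨p, q, hpq, k1⟩ := intervalGraph_adj.1 z1
    obtain ⟨p', q', -, k2⟩ := intervalGraph_adj.1 hyz
    have := eq_or_eq_of_common_neighbour (x := 1) (z := z.1) (g := p') (h := q') hab hcd
      hpq hne (by rw [k1, hy₁, one_mul])
      (by rw [k2, hy, one_mul]) (fun h ↦ hz (Subtype.ext (by rw [h, hx])))
    simpa using this
  have hthird : swap e f = swap a b * swap c d * swap a b := by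
    rcases key hcd n12 e2 z2 with k | k <;> rcases key hef n13 e3 z3 with k' | k' <;> rw [k] at k'
    · exact absurd (mul_left_cancel k') n23
    · rw [k', mul_assoc, swap_mul_self, mul_one]
    · rw [mul_assoc, k', ← mul_assoc, swap_mul_self, one_mul]
    · exact absurd (mul_right_cancel k') n23
  have hc : ∀ {a b c : Fin n}, a ≠ b → a ≠ c → b ≠ c →
      swap a b * swap a c * swap a b = swap b c := by
    intro a b c h1 h2 h3
    ext i; simp only [Perm.mul_apply, swap_apply_def]; grind
  by_cases hca : c = a
  · subst hca
    have hdb : d ≠ b := by rintro rfl; exact n12 rfl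
    exact ⟨d, hcd.symm, hdb, .inl ⟨e2, by rw [e3, hthird, hc hab hcd hdb.symm]⟩⟩
  by_cases hda : d = a
  · subst hda
    have hcb : c ≠ b := by rintro rfl; exact n12 (swap_comm _ _)
    refine ⟨c, hcd, hcb, .inl ⟨by rw [e2, swap_comm], ?_⟩⟩
    rw [e3, hthird, swap_comm c d, hc hab hcd.symm hcb.symm]
  by_cases hcb : c = b
  · subst hcb
    refine ⟨d, hda, hcd.symm, .inr ⟨e2, ?_⟩⟩
    rw [e3, hthird, swap_comm a c, hc hab.symm hcd (Ne.symm hda)]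
  by_cases hdb : d = b
  · subst hdb
    refine ⟨c, hca, hcd, .inr ⟨by rw [e2, swap_comm], ?_⟩⟩
    rw [e3, hthird, swap_comm a d, swap_comm c d, hc hab.symm hcd.symm (Ne.symm hca)]
  · refine absurd ?_ hcomm
    ext i; simp only [Perm.mul_apply, swap_apply_def]; grind

/-- The transpositions below `w` are closed under passing to subintervals. -/
theorem bruhatLE_swap_of_le {w : Perm (Fin n)} {x z lo hi : Fin n} (h1 : lo ≤ x) (h2 : x < z)
    (h3 : z ≤ hi) (h : BruhatLE (swap lo hi) w) : BruhatLE (swap x z) w := by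
  have s1 : BruhatLE (swap x hi) w := by
    rcases h1.eq_or_lt with rfl | h1
    · exact h
    have hxh := h2.trans_le h3
    have k1 := h.mul_swap h1 (by
      simpa [swap_apply_of_ne_of_ne h1.ne' hxh.ne] using hxh)
    have k2 := k1.mul_swap (h1.trans hxh) (by
      simpa [swap_apply_of_ne_of_ne (h1.trans hxh).ne' hxh.ne',
        swap_apply_of_ne_of_ne h1.ne' hxh.ne] using h1)
    convert k2 using 1
    ext i; simp only [Perm.mul_apply, swap_apply_def]; grind
  rcases h3.eq_or_lt with rfl | h3
  · exact s1
  have k1 := s1.mul_swap h3 (by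
    simpa [swap_apply_of_ne_of_ne h2.ne' h3.ne] using h2)
  have k2 := k1.mul_swap (h2.trans h3) (by
    simpa [swap_apply_of_ne_of_ne h2.ne (h2.trans h3).ne,
      swap_apply_of_ne_of_ne h2.ne' h3.ne] using h3)
  convert k2 using 1
  ext i; simp only [Perm.mul_apply, swap_apply_def]; grind

theorem bruhatLE_swap_mul_swap {w : Perm (Fin n)} {a b c lo hi : Fin n} (hab : a ≠ b) (hac : a ≠ c)
    (hbc : b ≠ c) (ha : lo ≤ a ∧ a ≤ hi) (hb : lo ≤ b ∧ b ≤ hi) (hc : lo ≤ c ∧ c ≤ hi)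
    (h : BruhatLE (swap lo hi) w) : BruhatLE (swap a b * swap a c) w := by
  have key : ∀ {x y z : Fin n}, x < y → y < z → lo ≤ x → z ≤ hi →
      BruhatLE (swap x z * swap x y) w ∧ BruhatLE (swap z x * swap z y) w := by
    intro x y z hxy hyz hx hz
    have := bruhatLE_swap_of_le hx (hxy.trans hyz) hz h
    refine ⟨this.mul_swap hxy ?_, ?_⟩
    · simpa [swap_apply_of_ne_of_ne hxy.ne' hyz.ne] using hyz
    · rw [swap_comm z x, swap_comm z y]
      exact this.mul_swap hyz (by simpa [swap_apply_of_ne_of_ne hxy.ne' hyz.ne] using hxy)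
  have e1 : swap a b * swap a c = swap c a * swap c b := by
    ext i; simp only [Perm.mul_apply, swap_apply_def]; grind
  have e2 : swap a b * swap a c = swap b c * swap b a := by
    ext i; simp only [Perm.mul_apply, swap_apply_def]; grind
  rcases lt_or_gt_of_ne hab with h1 | h1 <;> rcases lt_or_gt_of_ne hac with h2 | h2 <;>
    rcases lt_or_gt_of_ne hbc with h3 | h3
  · rw [e1]; exact (key h1 h3 ha.1 hc.2).2
  · exact (key h2 h3 ha.1 hb.2).1
  · exact absurd (h1.trans h3) h2.not_gt
  · rw [e2]; exact (key h2 h1 hc.1 hb.2).2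
  · rw [e2]; exact (key h1 h2 hb.1 hc.2).1
  · exact absurd (h2.trans h3) h1.not_gt
  · exact (key h3 h2 hb.1 ha.2).2
  · rw [e1]; exact (key h3 h1 hc.1 ha.2).1

/-- There is no book at `1`: of the three letters completing the spine `(a b)`, two lie on the same
side of `b`, and all transpositions among these two letters and `a` lie below `w`. -/
theorem not_hasBook_one {w : Perm (Fin n)} {x : bruhatInterval 1 w} (hx : x.1 = 1) :
    ¬ HasBook (intervalGraph 1 w) x := by
  rintro ⟨f, g, hg, hne⟩
  obtain ⟨a, b, hab, hf⟩ := intervalGraph_adj.1 (hg 0).2.1.1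
  rw [hx, one_mul] at hf
  wlog hlt : a < b generalizing a b
  · exact this b a hab.symm (by rw [hf, swap_comm]) (lt_of_le_of_ne (not_lt.1 hlt) hab.symm)
  have : ∀ i, ∃ c s, c ≠ a ∧ c ≠ b ∧ (g i s).1 = swap a c ∧ BruhatLE (swap b c) w ∧
      TwoCommon (intervalGraph 1 w) x (g i s) (g i s) := by
    intro i
    obtain ⟨c, hca, hcb, ⟨h1, h2⟩ | ⟨h1, h2⟩⟩ := (hg i).exists_third hx hab hf
    · exact ⟨c, false, hca, hcb, h1, h2 ▸ mem_interval.1 (g i true).2, (hg i).twoCommon.2.1⟩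
    · exact ⟨c, true, hca, hcb, h2, h1 ▸ mem_interval.1 (g i false).2, (hg i).twoCommon.2.2⟩
  choose c s hca hcb hgc hbc htwo using this
  -- two of the three further letters lie on the same side of `b`
  obtain ⟨i, j, hij, hside⟩ : ∃ i j, i ≠ j ∧ decide (c i < b) = decide (c j < b) :=
    Fintype.exists_ne_map_eq_of_card_lt (fun i ↦ decide (c i < b)) (by simp)
  have hcc : c i ≠ c j := by
    intro h
    have hgg : g i (s i) = g j (s j) := Subtype.ext (by rw [hgc, hgc, h])
    exact hne i j hij (s i) (s j) (hgg ▸ htwo i)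
  have hle : ∀ i, BruhatLE (swap a (c i)) w := fun i ↦ hgc i ▸ mem_interval.1 (g i (s i)).2
  have hfw : BruhatLE (swap a b) w := hf ▸ mem_interval.1 f.2
  obtain ⟨lo, hi, ha, hi', hj', hlohi⟩ : ∃ lo hi, (lo ≤ a ∧ a ≤ hi) ∧ (lo ≤ c i ∧ c i ≤ hi) ∧
      (lo ≤ c j ∧ c j ≤ hi) ∧ BruhatLE (swap lo hi) w := by
    by_cases hi : c i < b
    · have hj : c j < b := by simpa [hi] using hside
      have hmin : ∀ u, (u = a ∨ u = c i ∨ u = c j) → BruhatLE (swap u b) w := by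
        rintro u (rfl | rfl | rfl)
        exacts [hfw, swap_comm b (c i) ▸ hbc i, swap_comm b (c j) ▸ hbc j]
      refine ⟨min a (min (c i) (c j)), b, ⟨min_le_left _ _, hlt.le⟩,
        ⟨(min_le_right _ _).trans (min_le_left _ _), hi.le⟩,
        ⟨(min_le_right _ _).trans (min_le_right _ _), hj.le⟩, hmin _ ?_⟩
      rcases min_choice a (min (c i) (c j)) with h | h
      · exact .inl h
      · rw [h]; exact .inr (min_choice _ _)
    · have hj : ¬ c j < b := by simpa [hi] using hside
      have hai := hlt.trans_le (not_lt.1 hi)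
      have haj := hlt.trans_le (not_lt.1 hj)
      refine ⟨a, max (c i) (c j), ⟨le_rfl, hai.le.trans (le_max_left _ _)⟩,
        ⟨hai.le, le_max_left _ _⟩, ⟨haj.le, le_max_right _ _⟩, ?_⟩
      rcases max_choice (c i) (c j) with h | h <;> rw [h]
      exacts [hle i, hle j]
  have h1 := bruhatLE_swap_mul_swap (hca i).symm (hca j).symm hcc ha hi' hj' hlohi
  have h2 := bruhatLE_swap_mul_swap (hca j).symm (hca i).symm hcc.symm ha hj' hi' hlohi
  have h3 : BruhatLE (swap (c i) (c j)) w := by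
    rcases lt_or_gt_of_ne hcc with h | h
    · exact bruhatLE_swap_of_le hi'.1 h hj'.2 hlohi
    · rw [swap_comm]; exact bruhatLE_swap_of_le hj'.1 h hi'.2 hlohi
  exact hne i j hij (s i) (s j) (isTriangle_of_bruhatLE (y'' := ⟨_, mem_interval.2 h3⟩)
    (hca i).symm (hca j).symm hcc
    (by rw [hx, one_mul, hgc]) (by rw [hx, one_mul, hgc]) (by rw [hx, one_mul])
    (by rwa [hx, one_mul]) (by rwa [hx, one_mul])).twoCommon.1

/-- Vertex-transitivity excludes the pattern `34521`: it would give a book of three triangles at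
`w`, with spine the inversion `21`, but there is none at `1`. -/
theorem avoids_34521 {w : Perm (Fin n)} (hvt : IsVertexTransitive (intervalGraph 1 w))
    {p : Fin 3 → Fin n} {d e : Fin n} (hp : StrictMono p) (hpd : ∀ i, p i < d) (hde : d < e)
    (hw : StrictMono (w ∘ p)) (hwd : ∀ i, w d < w (p i)) (hwe : w e < w d) : False := by
  set top : bruhatInterval 1 w := ⟨w, mem_interval.2 .refl⟩ with htop
  have hpe : ∀ i, p i < e := fun i ↦ (hpd i).trans hde
  have hwpe : ∀ i, w e < w (p i) := fun i ↦ hwe.trans (hwd i)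
  have hf : BruhatLE (w * swap d e) w := .mul_swap .refl hde hwe
  set q : Bool → Fin n := fun s ↦ cond s e d with hq
  have hpq : ∀ i s, p i < q s := by rintro i (- | -); exacts [hpd i, hpe i]
  have hwq : ∀ i s, w (q s) < w (p i) := by rintro i (- | -); exacts [hwd i, hwpe i]
  have hg : ∀ i s, BruhatLE (w * swap (p i) (q s)) w := fun i s ↦
    .mul_swap .refl (hpq i s) (hwq i s)
  have hbook : HasBook (intervalGraph 1 w) top := by
    refine ⟨⟨_, mem_interval.2 hf⟩, fun i s ↦ ⟨_, mem_interval.2 (hg i s)⟩, fun i ↦ ?_, ?_⟩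
    · refine isTriangle_of_bruhatLE (a := d) (b := e) (c := p i) hde.ne (hpd i).ne' (hpe i).ne' rfl
        (by rw [swap_comm d]; rfl) (by rw [swap_comm e]; rfl) ?_ ?_
      · rw [swap_comm d (p i)]
        refine hf.mul_swap (hpd i) ?_
        simpa [swap_apply_of_ne_of_ne (hpd i).ne (hpe i).ne] using hwpe i
      · rw [swap_comm d (p i)]
        refine (hg i false).mul_swap hde ?_
        simpa [hq, swap_apply_of_ne_of_ne (hpe i).ne' hde.ne'] using hwpe i
    · intro i j hij s t h
      wlog hlt : i < j generalizing i j s t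
      · obtain ⟨z, z', h1, h2, h3, h4, h5, h6, h7⟩ := h
        exact this j i hij.symm t s ⟨z, z', h1, h2, h3, h5, h4, h7, h6⟩
          (lt_of_le_of_ne (not_lt.1 hlt) hij.symm)
      have hpp := hp hlt
      have hww : w (p i) < w (p j) := hw hlt
      obtain ⟨h1, h2, h3⟩ := h.bruhatLE (hpq i s).ne (hpq j t).ne
        (swap_ne_swap (hpq i s).ne hpp.ne (hpq i t).ne) rfl rfl
      have hst : q s = q t := by
        by_contra hst
        refine h3 ?_
        have := hpq i s
        have := hpq i t
        have := hpq j s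
        have := hpq j t
        ext k; simp only [Perm.mul_apply, swap_apply_def]; grind
      rw [hst] at h1 h2
      have hi := hpq i t
      have hj := hpq j t
      have hwj := hwq j t
      -- the pattern `231` on these three positions does not dominate `312`
      have hbad : ∀ z : Perm (Fin n), (∀ k < p i, z k = w k) → z (p i) = w (p j) →
          ¬ BruhatLE z w := by
        intro z hz hzi
        refine not_bruhatLE (p i) (w (p j)) (fun k hk hwk ↦ ?_) (p i) le_rfl hzi.ge hww
        rcases hk.eq_or_lt with rfl | hk
        · exact hzi.ge
        · rwa [hz k hk]
      refine hbad _ (fun k hk ↦ ?_) ?_ h2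
      · simp only [htop, mul_assoc, Perm.mul_apply, swap_apply_def]; grind
      · simp only [htop, mul_assoc, Perm.mul_apply, swap_apply_def]; grind
  obtain ⟨φ, hφ⟩ := hvt top ⟨1, mem_interval.2 (one_bruhatLE w)⟩
  exact not_hasBook_one (by rw [hφ]) (hbook.map φ)

/-- Inversion is an isomorphism from `Γ(1, w)` to `Γ(1, w⁻¹)`. -/
def invIso (w : Perm (Fin n)) : intervalGraph 1 w ≃g intervalGraph 1 w⁻¹ where
  toFun x := ⟨x.1⁻¹, mem_interval.2 (mem_interval.1 x.2).inv⟩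
  invFun x := ⟨x.1⁻¹, mem_interval.2 (by simpa using (mem_interval.1 x.2).inv)⟩
  left_inv x := by simp
  right_inv x := by simp
  map_rel_iff' {x y} := by
    rw [intervalGraph_adj, intervalGraph_adj]
    constructor
    · rintro ⟨p, q, hpq, h⟩
      refine ⟨x.1⁻¹ p, x.1⁻¹ q, x.1⁻¹.injective.ne hpq, ?_⟩
      have h' : y.1⁻¹ = x.1⁻¹ * swap p q := h
      rw [← swap_mul_eq_mul_swap, ← inv_inj, h']
      simp
    · rintro ⟨p, q, hpq, h⟩
      refine ⟨x.1 p, x.1 q, x.1.injective.ne hpq, ?_⟩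
      change y.1⁻¹ = x.1⁻¹ * swap (x.1 p) (x.1 q)
      rw [h, mul_inv_rev, swap_inv, swap_mul_eq_mul_swap, inv_inv]

theorem IsVertexTransitive.inv {w : Perm (Fin n)} (h : IsVertexTransitive (intervalGraph 1 w)) :
    IsVertexTransitive (intervalGraph 1 w⁻¹) := by
  intro x y
  obtain ⟨φ, hφ⟩ := h ((invIso w).symm x) ((invIso w).symm y)
  exact ⟨((invIso w).symm.trans φ).trans (invIso w), by simp [hφ]⟩

/-! ### Supports and irreducibility -/

theorem bruhatLE_of_isReducedWord_append {w : Perm (Fin n)} {l l' : List (Fin (n - 1))}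
    (h : IsReducedWord w (l ++ l')) : BruhatLE (wordProd l) w := by
  induction l' using List.reverseRecOn generalizing w with
  | nil => rw [List.append_nil] at h; rw [h.1]; exact .refl
  | append_singleton l' i ih =>
    obtain ⟨h1, h2⟩ := h
    rw [← List.append_assoc, wordProd_append, wordProd_singleton] at h1
    have h3 := length_wordProd_le (l ++ l')
    have h4 := length_mul_simple_le (wordProd (l ++ l')) i
    rw [← List.append_assoc, List.length_append, List.length_singleton] at h2
    rw [h1] at h4
    refine (ih ⟨rfl, by omega⟩).tail ⟨simple i, ⟨1, i, by simp⟩, h1.symm, by omega⟩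

theorem simple_apply_le {i k : Fin (n - 1)} (h : i ≠ k) (j : Fin n) :
    (simple i j).1 ≤ k.1 ↔ j.1 ≤ k.1 := by
  have := Fin.val_ne_of_ne h
  rw [simple, swap_apply_def]
  split_ifs with h1 h2
  · subst h1; simp; omega
  · subst h2; simp; omega
  · rfl

theorem wordProd_apply_le {l : List (Fin (n - 1))} {k : Fin (n - 1)} (h : k ∉ l) (j : Fin n) :
    (wordProd l j).1 ≤ k.1 ↔ j.1 ≤ k.1 := by
  induction l with
  | nil => rfl
  | cons i l ih =>
    rw [List.mem_cons, not_or] at h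
    have e : wordProd (i :: l) j = simple i (wordProd l j) := by simp [wordProd]
    rw [e, simple_apply_le (Ne.symm h.1), ih h.2]

/-- A permutation whose support contains the `k`-th generator does not preserve the initial
segment of the positions up to `k`. -/
theorem exists_lt_apply_of_mem_supp {w : Perm (Fin n)} {k : Fin (n - 1)} (h : k ∈ supp w) :
    ∃ j : Fin n, j.1 ≤ k.1 ∧ k.1 < (w j).1 := by
  obtain ⟨l, hl, hk⟩ := h
  obtain ⟨l₁, l₂, rfl, hk₁⟩ := List.eq_append_cons_of_mem hk
  have hl' : IsReducedWord w ((l₁ ++ [k]) ++ l₂) := by simpa using hl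
  have hle := (bruhatLE_of_isReducedWord_append hl').rank_le ⟨k.1, by omega⟩ ⟨k.1 + 1, by omega⟩
  have hmem : (⟨k.1, by omega⟩ : Fin n) ∈
      rankSet (wordProd (l₁ ++ [k])) ⟨k.1, by omega⟩ ⟨k.1 + 1, by omega⟩ := by
    rw [mem_rankSet, wordProd_append, wordProd_singleton, Perm.mul_apply, simple, swap_apply_left]
    refine ⟨le_rfl, ?_⟩
    have := (wordProd_apply_le hk₁ ⟨k.1 + 1, by omega⟩).not.2 (by simp)
    rw [Fin.le_def]
    simp only
    omega
  obtain ⟨j, hj⟩ := Finset.card_pos.1 ((Finset.card_pos.2 ⟨_, hmem⟩).trans_le hle)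
  rw [mem_rankSet, Fin.le_def, Fin.le_def] at hj
  exact ⟨j, hj.1, hj.2⟩

theorem supp_subset_of_fix_ge {w : Perm (Fin n)} {c : ℕ} (h : ∀ i : Fin n, c < i.1 → w i = i) :
    ∀ k ∈ supp w, k.1 < c := by
  intro k hk
  obtain ⟨j, hj, hwj⟩ := exists_lt_apply_of_mem_supp hk
  by_contra hkc
  have h1 := h (w j) (by omega)
  rw [w.injective h1] at hwj
  omega

theorem supp_subset_of_fix_lt {w : Perm (Fin n)} {c : ℕ} (h : ∀ i : Fin n, i.1 < c → w i = i) :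
    ∀ k ∈ supp w, c ≤ k.1 := by
  intro k hk
  obtain ⟨j, hj, hwj⟩ := exists_lt_apply_of_mem_supp hk
  by_contra hkc
  rw [h j (by omega)] at hwj
  omega

/-- If `w` maps the letters below `c` to letters up to `c`, it factors into a permutation of the
letters up to `c` and a permutation of the letters from `c` on. -/
theorem exists_factorization {w : Perm (Fin n)} {c : Fin n} (h : ∀ i < c, w i ≤ c) :
    ∃ u v : Perm (Fin n), w = u * v ∧ (∀ i : Fin n, c.1 < i.1 → u i = i) ∧
      ∀ i : Fin n, i.1 < c.1 → v i = i := by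
  obtain ⟨j, hj, hwj⟩ : ∃ j, c ≤ j ∧ w j ≤ c := by
    by_contra! hcon
    have : (Finset.Iic c).card ≤ (Finset.Iio c).card := by
      refine Finset.card_le_card_of_injOn w.symm (fun i hi ↦ ?_) w.symm.injective.injOn
      rw [SetLike.mem_coe, Finset.mem_Iic] at hi
      rw [SetLike.mem_coe, Finset.mem_Iio]
      by_contra hc
      exact (hcon _ (not_lt.1 hc)).not_ge (by simpa using hi)
    rw [Fin.card_Iic, Fin.card_Iio] at this
    omega
  set f : Fin n → Fin n := fun i ↦ if i < c then w i else if i = c then w j else i with hf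
  have hinj : Function.Injective f := by
    intro i i' hii
    have h1 := h i
    have h2 := h i'
    have h3 : w i = w i' → i = i' := fun h ↦ w.injective h
    have h4 : w i = w j → i = j := fun h ↦ w.injective h
    have h5 : w j = w i' → j = i' := fun h ↦ w.injective h
    simp only [hf] at hii
    grind
  set u : Perm (Fin n) := Equiv.ofBijective f (Finite.injective_iff_bijective.1 hinj) with hu
  have huf : ∀ i, u i = f i := fun i ↦ rfl
  refine ⟨u, u⁻¹ * w, by simp, fun i hi ↦ ?_, fun i hi ↦ ?_⟩
  · have : c < i := hi
    rw [huf, hf]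
    simp [this.not_gt, this.ne']
  · have : i < c := hi
    rw [Perm.mul_apply, Perm.inv_eq_iff_eq, huf, hf]
    simp [this]

theorem ne_one_of_fix {w : Perm (Fin n)} (hw : supp w = Set.univ) {c : ℕ} (hc : 0 < c)
    (hcn : c + 1 < n) {u v : Perm (Fin n)} (hu : ∀ i : Fin n, c < i.1 → u i = i)
    (hv : ∀ i : Fin n, i.1 < c → v i = i) : u ≠ w ∧ v ≠ w := by
  constructor
  · rintro rfl
    have := supp_subset_of_fix_ge hu ⟨c, by omega⟩ (by rw [hw]; trivial)
    simp at this
  · rintro rfl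
    have := supp_subset_of_fix_lt hv ⟨c - 1, by omega⟩ (by rw [hw]; trivial)
    simp only at this
    omega

theorem disjoint_supp_of_fix {c : ℕ} {u v : Perm (Fin n)} (hu : ∀ i : Fin n, c < i.1 → u i = i)
    (hv : ∀ i : Fin n, i.1 < c → v i = i) : Disjoint (supp u) (supp v) := by
  rw [Set.disjoint_left]
  intro k hk hk'
  have h1 := supp_subset_of_fix_ge hu k hk
  have h2 := supp_subset_of_fix_lt hv k hk'
  omega

theorem BruhatIrreducible.exists_lt_apply {w : Perm (Fin n)} (hw : BruhatIrreducible w) {c : Fin n}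
    (hc : 0 < c.1) (hcn : c.1 + 1 < n) : ∃ i < c, c < w i := by
  by_contra! h
  obtain ⟨u, v, huv, hu, hv⟩ := exists_factorization h
  obtain ⟨h1, h2⟩ := ne_one_of_fix hw.1 hc hcn hu hv
  refine hw.2 ⟨u, v, ?_, ?_, huv, disjoint_supp_of_fix hu hv⟩
  · rintro rfl; exact h2 (by simp [huv])
  · rintro rfl; exact h1 (by simp [huv])

theorem BruhatIrreducible.exists_lt_inv_apply {w : Perm (Fin n)} (hw : BruhatIrreducible w)
    {c : Fin n} (hc : 0 < c.1) (hcn : c.1 + 1 < n) : ∃ i < c, c < w⁻¹ i := by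
  by_contra! h
  obtain ⟨u, v, huv, hu, hv⟩ := exists_factorization h
  have huv' : w = v⁻¹ * u⁻¹ := by rw [← mul_inv_rev, ← huv, inv_inv]
  have hu' : ∀ i : Fin n, c.1 < i.1 → u⁻¹ i = i := fun i hi ↦ by
    rw [Perm.inv_eq_iff_eq, hu i hi]
  have hv' : ∀ i : Fin n, i.1 < c.1 → v⁻¹ i = i := fun i hi ↦ by
    rw [Perm.inv_eq_iff_eq, hv i hi]
  obtain ⟨h1, h2⟩ := ne_one_of_fix hw.1 hc hcn hu' hv'
  refine hw.2 ⟨v⁻¹, u⁻¹, ?_, ?_, huv', (disjoint_supp_of_fix hu' hv').symm⟩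
  · intro h; exact h1 (by rw [huv', h, one_mul])
  · intro h; exact h2 (by rw [huv', h, mul_one])

/-! ### The pattern `2341` -/

/-- An irreducible vertex-transitive `w` avoids `2341`. For a pattern `2341` at positions
`l < p < h < q` with `w p` as large as possible, nothing lies to the upper left of `p`.
Irreducibility at the cut `p` gives an entry `x` to the lower right of `p` with `w x < w l`, and
irreducibility at the cut `h` gives an entry `y` beyond `h` with `w y < w p`; the excluded patterns
force `p, x, y, q` to be a pattern `4231`. -/
theorem avoids_2341 {w : Perm (Fin n)} (hvt : IsVertexTransitive (intervalGraph 1 w))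
    (hirr : ∀ c : Fin n, 0 < c.1 → c.1 + 1 < n → ∃ i < c, c < w i) {l p h q : Fin n} (hlp : l < p)
    (hph : p < h) (hhq : h < q) (h1 : w q < w l) (h2 : w l < w p) (h3 : w p < w h) : False := by
  have a3412 := @avoids_3412 n w hvt
  have a4231 := @avoids_4231 n w hvt
  have a34521 : ∀ {a b c d e : Fin n}, a < b → b < c → c < d → d < e → w e < w d → w d < w a →
      w a < w b → w b < w c → False := by
    intro a b c d e hab hbc hcd hde k1 k2 k3 k4
    refine avoids_34521 hvt (p := ![a, b, c]) (d := d) (e := e) ?_ ?_ hde ?_ ?_ k1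
    · rw [Fin.strictMono_iff_lt_succ]
      intro i; fin_cases i; exacts [hab, hbc]
    · intro i; fin_cases i; exacts [(hab.trans hbc).trans hcd, hbc.trans hcd, hcd]
    · rw [Fin.strictMono_iff_lt_succ]
      intro i; fin_cases i; exacts [k3, k4]
    · intro i; fin_cases i; exacts [k2, k2.trans k3, (k2.trans k3).trans k4]
  -- choose `p` with the largest value among all such patterns
  obtain ⟨p, hpmem, hpmax⟩ := Set.exists_max_image
    {p | ∃ l h q, l < p ∧ p < h ∧ h < q ∧ w q < w l ∧ w l < w p ∧ w p < w h} w (Set.toFinite _)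
    ⟨p, l, h, q, hlp, hph, hhq, h1, h2, h3⟩
  clear hlp hph hhq h1 h2 h3
  obtain ⟨l₀, h₀, q, hlp₀, hph₀, hhq₀, h1₀, h2₀, h3₀⟩ := hpmem
  have hNW : ∀ u < p, w u < w p := by
    intro u hu
    by_contra hcon
    have hup : w p < w u := lt_of_le_of_ne (not_lt.1 hcon) (w.injective.ne hu.ne')
    have hlu : l₀ < u := by
      by_contra hlu
      have hlu' : u < l₀ := lt_of_le_of_ne (not_lt.1 hlu) (by rintro rfl; exact h2₀.not_gt hup)
      exact a4231 hlu' hlp₀ (hph₀.trans hhq₀) h1₀ h2₀ hup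
    have huh : w u < w h₀ := by
      by_contra huh
      have huh' : w h₀ < w u := lt_of_le_of_ne (not_lt.1 huh)
        (w.injective.ne (hu.trans hph₀).ne')
      exact a4231 hu hph₀ hhq₀ (h1₀.trans h2₀) h3₀ huh'
    exact hcon (lt_of_le_of_ne (hpmax u ⟨l₀, h₀, q, hlu, hu.trans hph₀, hhq₀, h1₀, h2₀.trans hup,
      huh⟩) (w.injective.ne hu.ne))
  -- the highest entry to the left of `p`, and the first entry to the upper right of `p`
  obtain ⟨l, hlp, hlmax⟩ := Set.exists_max_image {l | l < p} w (Set.toFinite _) ⟨l₀, hlp₀⟩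
  obtain ⟨h, ⟨hph, h3⟩, hhmin⟩ := Set.exists_min_image {h | p < h ∧ w p < w h} id (Set.toFinite _)
    ⟨h₀, hph₀, h3₀⟩
  have hlp : l < p := hlp
  have hhq : h < q := (hhmin h₀ ⟨hph₀, h3₀⟩).trans_lt hhq₀
  have h1 : w q < w l := h1₀.trans_le (hlmax l₀ hlp₀)
  have h2 : w l < w p := hNW l hlp
  obtain ⟨x, hpx, hxq, hxl⟩ : ∃ x, p < x ∧ x ≠ q ∧ w x < w l := by
    by_contra! hcon
    obtain ⟨i, hip, hwi⟩ := hirr p (by have := Fin.lt_def.1 hlp; omega)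
      (by have := Fin.lt_def.1 hph; omega)
    have hpl : p < w l := hwi.trans_le (hlmax i hip)
    have : (Finset.Iic (w l)).card ≤ (insert q (Finset.Iio p)).card := by
      refine Finset.card_le_card_of_injOn w.symm (fun v hv ↦ ?_) w.symm.injective.injOn
      rw [SetLike.mem_coe, Finset.mem_Iic] at hv
      rw [SetLike.mem_coe, Finset.mem_insert, Finset.mem_Iio]
      by_contra! hc
      obtain ⟨x, rfl⟩ := w.surjective v
      rw [symm_apply_apply] at hc
      rcases hc.2.eq_or_lt with rfl | hpx
      · exact hv.not_gt h2
      · rcases hv.eq_or_lt with hv | hv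
        · rw [w.injective hv] at hpx; exact hlp.not_gt hpx
        · exact (hcon x hpx hc.1).not_gt hv
    have h5 := Finset.card_insert_le q (Finset.Iio p)
    rw [Fin.card_Iic] at this
    rw [Fin.card_Iio] at h5
    have := Fin.lt_def.1 hpl
    omega
  obtain ⟨y, hhy, hyq, hyp⟩ : ∃ y, h < y ∧ y ≠ q ∧ w y < w p := by
    by_contra! hcon
    obtain ⟨i, hih, hwi⟩ := hirr h (by have := Fin.lt_def.1 hph; omega)
      (by have := Fin.lt_def.1 hhq; omega)
    have hip : w i ≤ w p := by
      by_contra hip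
      rcases lt_trichotomy i p with hi | rfl | hi
      · exact hip (hNW i hi).le
      · exact hip le_rfl
      · exact (hhmin i ⟨hi, not_le.1 hip⟩).not_gt hih
    have hhp : h < w p := hwi.trans_le hip
    have : (Finset.Iic (w p)).card ≤ (insert q (Finset.Iio h)).card := by
      refine Finset.card_le_card_of_injOn w.symm (fun v hv ↦ ?_) w.symm.injective.injOn
      rw [SetLike.mem_coe, Finset.mem_Iic] at hv
      rw [SetLike.mem_coe, Finset.mem_insert, Finset.mem_Iio]
      by_contra! hc
      obtain ⟨x, rfl⟩ := w.surjective v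
      rw [symm_apply_apply] at hc
      rcases hc.2.eq_or_lt with rfl | hpx
      · exact hv.not_gt h3
      · rcases hv.eq_or_lt with hv | hv
        · rw [w.injective hv] at hpx; exact hph.not_gt hpx
        · exact (hcon x hpx hc.1).not_gt hv
    have h5 := Finset.card_insert_le q (Finset.Iio h)
    rw [Fin.card_Iic] at this
    rw [Fin.card_Iio] at h5
    have := Fin.lt_def.1 hhp
    omega
  -- an entry to the lower right of `p` other than `q` lies to the upper left of `q`
  have hSE : ∀ z, p < z → z ≠ q → w z < w p → z < q ∧ w q < w z := by
    intro z hpz hzq hzp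
    have hzh : z ≠ h := by rintro rfl; exact hzp.not_gt h3
    have hwzq := w.injective.ne hzq
    rcases lt_or_gt_of_ne hzq with k | k <;> rcases lt_or_gt_of_ne hwzq with k' | k'
    · exfalso
      rcases lt_or_gt_of_ne hzh with k2 | k2
      · exact a3412 hlp hpz k k' h1 h2
      · exact a3412 hph k2 k k' (h1.trans h2) h3
    · exact ⟨k, k'⟩
    · exact (a34521 hlp hph hhq k k' h1 h2 h3).elim
    · exact (a3412 hph hhq k k' hzp h3).elim
  obtain ⟨hxq', hqx⟩ := hSE x hpx hxq (hxl.trans h2)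
  obtain ⟨hyq', hqy⟩ := hSE y (hph.trans hhy) hyq hyp
  have hxh : x < h := by
    by_contra hxh
    have hhx : h < x := lt_of_le_of_ne (not_lt.1 hxh) (by rintro rfl; exact (hxl.trans h2).not_gt h3)
    exact a34521 hlp hph hhx hxq' hqx hxl h2 h3
  have hly : w l < w y := by
    by_contra hly
    have hyl : w y < w l := lt_of_le_of_ne (not_lt.1 hly)
      (w.injective.ne ((hlp.trans hph).trans hhy).ne')
    exact a34521 hlp hph hhy hyq' hqy hyl h2 h3
  exact a4231 hpx (hxh.trans hhy) hyq' hqx (hxl.trans hly) hyp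

/-! ### Longest elements of parabolic subgroups -/

/-- For `a < b`, the letters `a` and `b` lie in the same block of `J`: all generators between them are
in `J`. The condition is vacuous for `b ≤ a`. -/
def SameBlock (J : Set (Fin (n - 1))) (a b : Fin n) : Prop :=
  ∀ k : Fin (n - 1), a.1 ≤ k.1 → k.1 < b.1 → k ∈ J

/-- `x` preserves the blocks of `J`, in the form that it preserves each initial segment of letters
that ends at a generator outside `J`. -/
def PreservesBlocks (J : Set (Fin (n - 1))) (x : Perm (Fin n)) : Prop :=
  ∀ k ∉ J, ∀ j : Fin n, (x j).1 ≤ k.1 ↔ j.1 ≤ k.1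

theorem PreservesBlocks.mul {J : Set (Fin (n - 1))} {x y : Perm (Fin n)}
    (hx : PreservesBlocks J x) (hy : PreservesBlocks J y) : PreservesBlocks J (x * y) :=
  fun k hk j ↦ (hx k hk (y j)).trans (hy k hk j)

theorem PreservesBlocks.mono {J J' : Set (Fin (n - 1))} (h : J ⊆ J') {x : Perm (Fin n)}
    (hx : PreservesBlocks J x) : PreservesBlocks J' x :=
  fun k hk ↦ hx k fun h' ↦ hk (h h')

theorem SameBlock.mono {J J' : Set (Fin (n - 1))} (h : J ⊆ J') {a b : Fin n}
    (hab : SameBlock J a b) : SameBlock J' a b :=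
  fun k h1 h2 ↦ h (hab k h1 h2)

theorem PreservesBlocks.sameBlock {J : Set (Fin (n - 1))} {x : Perm (Fin n)}
    (hx : PreservesBlocks J x) {a b : Fin n} (h : SameBlock J a b) :
    SameBlock J (x a) (x b) := by
  intro k h1 h2
  by_contra hk
  have ha := (hx k hk a).1 h1
  have hb := (hx k hk b).not.1 (by omega)
  exact hk (h k ha (by omega))

/-- Two letters whose order is reversed by `x` have images in the same block. If the order is kept,
the conclusion holds vacuously. -/
theorem PreservesBlocks.sameBlock_symm {J : Set (Fin (n - 1))} {x : Perm (Fin n)}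
    (hx : PreservesBlocks J x) {a b : Fin n} (hab : a < b) : SameBlock J (x b) (x a) := by
  intro k h1 h2
  by_contra hk
  have ha := (hx k hk b).1 h1
  have hb := (hx k hk a).not.1 (by omega)
  have := Fin.lt_def.1 hab
  omega

theorem PreservesBlocks.lt {J : Set (Fin (n - 1))} {x : Perm (Fin n)}
    (hx : PreservesBlocks J x) {a b : Fin n} (h : ¬ SameBlock J a b) : x a < x b := by
  rw [SameBlock] at h
  push Not at h
  obtain ⟨k, h1, h2, hk⟩ := h
  have h3 := (hx k hk a).2 h1
  have h4 := (hx k hk b).not.2 (by omega)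
  exact Fin.lt_def.2 (by omega)

theorem preservesBlocks_of_mem_parabolic {J : Set (Fin (n - 1))} {x : Perm (Fin n)}
    (hx : x ∈ parabolic J) : PreservesBlocks J x := by
  induction hx using Subgroup.closure_induction with
  | mem x hx =>
    obtain ⟨i, hi, rfl⟩ := hx
    exact fun k hk j ↦ simple_apply_le (by rintro rfl; exact hk hi) j
  | one => exact fun k _ j ↦ Iff.rfl
  | mul x y _ _ hx hy => exact hx.mul hy
  | inv x _ hx =>
    intro k hk j
    have := hx k hk (x⁻¹ j)
    rw [← Perm.mul_apply, mul_inv_cancel, Perm.one_apply] at this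
    exact this.symm

/-- If all `k ∈ J` are right descents, then the one-line notation decreases on each block. -/
theorem lt_of_sameBlock {x : Perm (Fin n)} {a b : Fin n}
    (hab : a < b) (h : SameBlock (rightDescents x) a b) : x b < x a := by
  induction hk : b.1 generalizing b with
  | zero => rw [Fin.lt_def] at hab; omega
  | succ m ih =>
    have hm := h ⟨m, by omega⟩ (by rw [Fin.lt_def] at hab; simp only; omega) (by simp [hk])
    rw [mem_rightDescents] at hm
    have hb : (⟨m + 1, by omega⟩ : Fin n) = b := Fin.ext hk.symm
    simp only [hb] at hm
    rcases eq_or_ne a.1 m with e | e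
    · have : a = ⟨m, by omega⟩ := Fin.ext e
      rwa [this]
    · refine hm.trans (ih (b := ⟨m, by omega⟩) ?_ (fun k h1 h2 ↦ h k h1 ?_) rfl)
      · rw [Fin.lt_def] at hab ⊢; simp only; omega
      · simp only at h2; omega

theorem longest_preservesBlocks (J : Set (Fin (n - 1))) : PreservesBlocks J (longest J) :=
  preservesBlocks_of_mem_parabolic (exists_longest J).choose_spec.1

theorem subset_rightDescents_longest (J : Set (Fin (n - 1))) : J ⊆ rightDescents (longest J) := by
  intro i hi
  obtain ⟨hmem, hmax⟩ := (exists_longest J).choose_spec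
  rw [mem_rightDescents]
  by_contra h
  have hlt : (⟨i.1, by omega⟩ : Fin n) < ⟨i.1 + 1, by omega⟩ := by simp [Fin.lt_def]
  have h1 := length_lt_mul_swap hlt
    (lt_of_le_of_ne (not_lt.1 h) ((longest J).injective.ne hlt.ne))
  exact (hmax _ ((parabolic J).mul_mem hmem
    (Subgroup.subset_closure (Set.mem_image_of_mem simple hi)))).not_gt h1

/-- The inversions of the longest element of `W_J` are the pairs in a common block of `J`. -/
theorem longest_lt_iff {J : Set (Fin (n - 1))} {a b : Fin n} (hab : a < b) :
    longest J b < longest J a ↔ SameBlock J a b := by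
  refine ⟨fun h ↦ ?_, fun h ↦ lt_of_sameBlock hab (h.mono (subset_rightDescents_longest J))⟩
  by_contra hn
  exact ((longest_preservesBlocks J).lt hn).not_gt h

theorem eq_of_inversions {x y : Perm (Fin n)}
    (h : ∀ a b : Fin n, a < b → (x b < x a ↔ y b < y a)) : x = y := by
  have : y * x⁻¹ = 1 := by
    apply eq_one_of_strictMono
    intro i j hij
    obtain ⟨a, rfl⟩ := x.surjective i
    obtain ⟨b, rfl⟩ := x.surjective j
    have hx : ∀ c, (y * x⁻¹) (x c) = y c := fun c ↦ by simp
    rw [hx, hx]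
    have hne : a ≠ b := by rintro rfl; exact lt_irrefl _ hij
    rcases lt_or_gt_of_ne hne with hab | hab
    · exact lt_of_le_of_ne (not_lt.1 ((h a b hab).not.1 hij.not_gt)) (y.injective.ne hne)
    · exact (h b a hab).1 hij
  exact (mul_inv_eq_one.1 this).symm

theorem longest_mul_self (J : Set (Fin (n - 1))) : longest J * longest J = 1 := by
  apply eq_one_of_strictMono
  intro a b hab
  have hp := longest_preservesBlocks J
  rw [Perm.mul_apply, Perm.mul_apply]
  by_cases h : SameBlock J a b
  · exact (longest_lt_iff ((longest_lt_iff hab).2 h)).2 (hp.sameBlock_symm hab)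
  · exact ((hp.mul hp).lt h)

/-- A permutation all of whose inverted pairs of values lie in a common block preserves the
blocks. -/
theorem preservesBlocks_of_inversions {J : Set (Fin (n - 1))} {x : Perm (Fin n)}
    (h : ∀ a b : Fin n, a < b → x b < x a → SameBlock J (x b) (x a)) : PreservesBlocks J x := by
  intro k hk
  have hlt : ∀ i j : Fin n, (x i).1 ≤ k.1 → k.1 < (x j).1 → i < j := by
    intro i j hi hj
    by_contra hij
    have hne : j ≠ i := by rintro rfl; omega
    exact hk (h j i (lt_of_le_of_ne (not_lt.1 hij) hne) (Fin.lt_def.2 (by omega)) k hi hj)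
  have hkn : k.1 < n := by omega
  intro j
  constructor
  · intro hj
    by_contra hkj
    have : (Finset.Ioi (⟨k.1, hkn⟩ : Fin n)).card ≤ (Finset.Ioi j).card := by
      refine Finset.card_le_card_of_injOn x.symm (fun v hv ↦ ?_) x.symm.injective.injOn
      rw [SetLike.mem_coe, Finset.mem_Ioi] at hv ⊢
      exact hlt _ _ hj (by rw [apply_symm_apply]; exact hv)
    rw [Fin.card_Ioi, Fin.card_Ioi] at this
    simp only at this
    omega
  · intro hj
    by_contra hkj
    have : (Finset.Iic (⟨k.1, hkn⟩ : Fin n)).card ≤ (Finset.Iio j).card := by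
      refine Finset.card_le_card_of_injOn x.symm (fun v hv ↦ ?_) x.symm.injective.injOn
      rw [SetLike.mem_coe, Finset.mem_Iic] at hv
      rw [SetLike.mem_coe, Finset.mem_Iio]
      exact hlt _ _ (by rw [apply_symm_apply]; exact hv) (not_le.1 hkj)
    rw [Fin.card_Iic, Fin.card_Iio] at this
    simp only at this
    omega

/-- If each inversion of `w` lies in a run of consecutive descending positions or of consecutive
descending values, then `w = w₀(J) w₀(J ∩ J') w₀(J')`, where `J` and `J'` are its left and right
descent sets, and `w` preserves the blocks of `J ∪ J'`. -/
theorem eq_longest_mul {w : Perm (Fin n)} (hw : ∀ p q : Fin n, p < q → w q < w p →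
      SameBlock (rightDescents w) p q ∨ SameBlock (leftDescents w) (w q) (w p)) :
    w = longest (leftDescents w) * longest (leftDescents w ∩ rightDescents w) *
      longest (rightDescents w) ∧
    PreservesBlocks (leftDescents w ∪ rightDescents w) w := by
  set R := longest (rightDescents w) with hR
  set K := longest (leftDescents w ∩ rightDescents w) with hK
  have hRR : ∀ a, R (R a) = a := fun a ↦ by
    rw [← Perm.mul_apply, hR, longest_mul_self, Perm.one_apply]
  have hKK : ∀ a, K (K a) = a := fun a ↦ by
    rw [← Perm.mul_apply, hK, longest_mul_self, Perm.one_apply]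
  have hRp : PreservesBlocks (rightDescents w) R := longest_preservesBlocks _
  have hKp : PreservesBlocks (leftDescents w ∩ rightDescents w) K := longest_preservesBlocks _
  have hKL := hKp.mono Set.inter_subset_left
  have hR' : ∀ {a b : Fin n}, a < b → (R b < R a ↔ SameBlock (rightDescents w) a b) :=
    longest_lt_iff
  have hK' : ∀ {a b : Fin n}, a < b →
      (K b < K a ↔ SameBlock (leftDescents w ∩ rightDescents w) a b) := longest_lt_iff
  -- sorting the descending runs of `w` leaves only inversions within blocks of the left descents
  have hu : PreservesBlocks (leftDescents w) (w * R) := by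
    apply preservesBlocks_of_inversions
    intro a b hab hlt
    rw [Perm.mul_apply, Perm.mul_apply] at hlt ⊢
    rcases lt_or_gt_of_ne (R.injective.ne hab.ne) with h | h
    · refine (hw _ _ h hlt).resolve_left fun hb ↦ ?_
      have := (hR' h).2 hb
      rw [hRR, hRR] at this
      exact this.not_gt hab
    · exact absurd (lt_of_sameBlock h (hRp.sameBlock_symm hab)) hlt.not_gt
  have hz := hu.mul hKL
  have hmain : w * R * K = longest (leftDescents w) := by
    apply eq_of_inversions
    intro a b hab
    rw [longest_lt_iff hab]
    refine ⟨fun h ↦ ?_, fun h ↦ ?_⟩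
    · by_contra hn
      exact (hz.lt hn).not_gt h
    · by_contra hcon
      have hlt : (w * R * K) a < (w * R * K) b :=
        lt_of_le_of_ne (not_lt.1 hcon) ((w * R * K).injective.ne hab.ne)
      have hblock := hz.sameBlock h
      rw [leftDescents_eq] at hblock
      have hRba : R (K b) < R (K a) := by
        simpa using lt_of_sameBlock hlt hblock
      rcases lt_or_gt_of_ne (K.injective.ne hab.ne) with h1 | h1
      · have h2 := (hR' h1).1 hRba
        have h3 : SameBlock (leftDescents w ∩ rightDescents w) (K a) (K b) :=
          fun k hk hk' ↦ ⟨hKL.sameBlock h k hk hk', h2 k hk hk'⟩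
        have := (hK' h1).2 h3
        rw [hKK, hKK] at this
        exact this.not_gt hab
      · have h2 : SameBlock (rightDescents w) (K b) (K a) :=
          (hKp.sameBlock_symm hab).mono Set.inter_subset_right
        exact ((hR' h1).2 h2).not_gt hRba
  have hwR : w * R * R = w := by rw [mul_assoc, hR, longest_mul_self, mul_one]
  constructor
  · rw [← hmain, mul_assoc (w * R) K K, hK, longest_mul_self, mul_one, hwR]
  · have := (hu.mono Set.subset_union_left).mul
      (hRp.mono (Set.subset_union_right (s := leftDescents w)))
    rwa [hwR] at this

/-! ### The descending runs of `w` -/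

/-- If `w` does not descend all the way between the positions of an inversion, then, as `4231` is
avoided, some entry in between is not between the two values. -/
theorem exists_between_of_not_sameBlock {w : Perm (Fin n)}
    (hvt : IsVertexTransitive (intervalGraph 1 w)) {p q : Fin n} (hw : w q < w p)
    (h : ¬ SameBlock (rightDescents w) p q) : ∃ r, p < r ∧ r < q ∧ (w p < w r ∨ w r < w q) := by
  rw [SameBlock] at h
  push Not at h
  obtain ⟨k, hpk, hkq, hk⟩ := h
  rw [mem_rightDescents, not_lt] at hk
  set r : Fin n := ⟨k.1, by omega⟩ with hr
  set s : Fin n := ⟨k.1 + 1, by omega⟩ with hs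
  have hrs : r < s := by simp [hr, hs, Fin.lt_def]
  have hwrs : w r < w s := lt_of_le_of_ne hk (w.injective.ne hrs.ne)
  have hpr : p ≤ r := hpk
  have hsq : s ≤ q := hkq
  rcases hpr.eq_or_lt with e | hpr
  · have hsq' : s ≠ q := by rintro e'; rw [← e, e'] at hwrs; exact hwrs.not_gt hw
    exact ⟨s, e ▸ hrs, lt_of_le_of_ne hsq hsq', .inl (e ▸ hwrs)⟩
  rcases hsq.eq_or_lt with e | hsq
  · exact ⟨r, hpr, e ▸ hrs, .inr (e ▸ hwrs)⟩
  by_cases h1 : w p < w s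
  · exact ⟨s, hpr.trans hrs, hsq, .inl h1⟩
  by_cases h2 : w r < w q
  · exact ⟨r, hpr, hrs.trans hsq, .inr h2⟩
  exact (avoids_4231 hvt hpr hrs hsq
    (lt_of_le_of_ne (not_lt.1 h2) (w.injective.ne (hrs.trans hsq).ne')) hwrs
    (lt_of_le_of_ne (not_lt.1 h1) (w.injective.ne (hpr.trans hrs).ne'))).elim

theorem sameBlock_of_inversion {w : Perm (Fin n)} (hirr : BruhatIrreducible w)
    (hvt : IsVertexTransitive (intervalGraph 1 w)) {p q : Fin n} (hpq : p < q) (hw : w q < w p) :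
    SameBlock (rightDescents w) p q ∨ SameBlock (leftDescents w) (w q) (w p) := by
  by_contra! hcon
  obtain ⟨hR, hL⟩ := hcon
  obtain ⟨r, hpr, hrq, hr⟩ := exists_between_of_not_sameBlock hvt hw hR
  rw [leftDescents_eq] at hL
  obtain ⟨v, hqv, hvp, hv⟩ := exists_between_of_not_sameBlock hvt.inv (by simpa using hpq) hL
  obtain ⟨s, rfl⟩ := w.surjective v
  have hinv : ∀ c, w⁻¹ (w c) = c := fun c ↦ by simp
  rw [hinv, hinv, hinv] at hv
  rcases hr with hr | hr <;> rcases hv with hs | hs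
  · exact avoids_3412 hvt hpr hrq hs hqv hvp hr
  · exact avoids_2341 hvt (fun c hc hcn ↦ hirr.exists_lt_apply hc hcn) hs hpr hrq hqv hvp hr
  · exact avoids_2341 hvt.inv (fun c hc hcn ↦ hirr.exists_lt_inv_apply hc hcn) hr hqv hvp
      (by simpa using hpr) (by simpa using hrq) (by simpa using hs)
  · exact avoids_3412 hvt hs hpr hrq hr hqv hvp

end BruhatOrbit

open BruhatOrbit

theorem proposition5p8 (n : ℕ) (w : Equiv.Perm (Fin n))
    (hw : BruhatOrbit.BruhatIrreducible w)
    (hvt : BruhatOrbit.IsVertexTransitive (BruhatOrbit.intervalGraph 1 w)) :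
    BruhatOrbit.orbitTop w = w ∧
      BruhatOrbit.identityOrbit w = BruhatOrbit.bruhatInterval 1 (BruhatOrbit.orbitTop w) := by
  obtain ⟨h1, h2⟩ := eq_longest_mul fun p q hpq h ↦ sameBlock_of_inversion hw hvt hpq h
  -- a generator outside both descent sets would be missing from the support
  have hdesc : ∀ i, i ∈ leftDescents w ∪ rightDescents w := by
    intro i
    by_contra hi
    obtain ⟨j, hj, hwj⟩ := exists_lt_apply_of_mem_supp (w := w) (k := i) (by rw [hw.1]; trivial)
    have := (h2 i hi j).2 hj
    omega
  have hright : rightProd w = 1 := by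
    have : ∀ i, ¬ RightAlmostReducible w i := fun i ⟨_, _, _, h, h'⟩ ↦ (hdesc i).elim h h'
    simp [rightProd, this, wordProd]
  have hleft : leftProd w = 1 := by
    have : ∀ i, ¬ LeftAlmostReducible w i := fun i ⟨_, _, _, h, h'⟩ ↦ (hdesc i).elim h h'
    simp [leftProd, this, wordProd]
  have htop : orbitTop w = w := by
    rw [orbitTop, hright, hleft, mul_one, mul_one]
    exact h1.symm
  refine ⟨htop, ?_⟩
  rw [htop]
  ext x
  constructor
  · rintro ⟨φ, rfl⟩
    exact Subtype.prop _
  · intro hx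
    obtain ⟨φ, hφ⟩ := hvt ⟨1, mem_interval.2 (one_bruhatLE w)⟩ ⟨x, hx⟩
    exact ⟨φ, congrArg Subtype.val hφ⟩
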